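/- **Setting.** Let $\Omega\subset\mathbb{R}_{\ge 0}$ be finite, $d$ a probability distribution on $\Omega$, and $\mathcal{H}_g$ a complex Hilbert space. A *quantum sampler* for $d$ is a unitary $\mathcal{S}$ on $\mathcal{H}_g\otimes\mathbb{C}^{\Omega}$ with $$\mathcal{S}(|0\rangle|0\rangle)=\sum_{x\in\Omega}\sqrt{d(x)}\,|\psi_x\rangle|x\rangle$$ for some unit vectors $|\psi_x\rangle\in\mathcal{H}_g$, where $|0\rangle|0\rangle$ is a product of two fixed known unit vectors. Write $\mu_{\mathcal{S}}=\sum_x d(x)\,x$ and $\phi_{\mathcal{S}}=\bigl(\sum_x d(x)\,x^2\bigr)^{1/2}$. A *quantum sample* is one execution of $\mathcal{S}$ or $\mathcal{S}^{-1}$, possibly controlled. An *algorithm* is a classically controlled (adaptive) quantum procedure with a finite workspace register that uses $\mathcal{S}$ only as a black box, through quantum samples; operations that do not involve $\mathcal{S}$ (unitaries, measurements, re-initialisation) are free. **Theorem.** There is an algorithm that, given a sampler $\mathcal{S}$, an integer $\Delta$, a value $H>0$ and two reals $0<\epsilon,\delta<1$, has the following property. If $\mu_{\mathcal{S}}>0$,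 $\Delta\ge\phi_{\mathcal{S}}/\mu_{\mathcal{S}}$ and $H>\mu_{\mathcal{S}}$, then the algorithm halts with probability $1$, its output $\widetilde\mu_{\mathcal{S}}$ satisfies $|\widetilde\mu_{\mathcal{S}}-\mu_{\mathcal{S}}|\le\epsilon\,\mu_{\mathcal{S}}$ with probability at least $1-\delta$, and the expected number of quantum samples it uses is $$\widetilde{O}\!\left(\Delta\cdot\epsilon^{-1}\cdot\bigl(1+\log(H/\mu_{\mathcal{S}})\bigr)^3\cdot\bigl(1+\log(1/\delta)\bigr)\right).$$ Here $\widetilde{O}(X)$ means at most $C\cdot X\cdot\log^k(2+X)$ for absolute constants $C>0$ and $k\in\mathbb{N}$, which do not depend on $\Omega$, $\mathcal{H}_g$, $\mathcal{S}$, $\Delta$, $H$, $\epsilon$, $\delta$. In particular no lower bound on $\mu_{\mathcal{S}}$ is given to the algorithm. -/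

import Mathlib

open scoped ENNReal

universe u

namespace QuantumSampling

/-! ### Distributions on a finite set of nonnegative reals -/

/-- The mean `∑ d(x) x`. -/
noncomputable def mean {Ω : Finset ℝ} (d : Ω → ℝ) : ℝ := ∑ x : Ω, d x * (x : ℝ)

/-- The square root `φ` of the second moment `∑ d(x) x²`. -/
noncomputable def rootSecondMoment {Ω : Finset ℝ} (d : Ω → ℝ) : ℝ :=
  Real.sqrt (∑ x : Ω, d x * (x : ℝ) ^ 2)

/-! ### Quantum samplers -/

/-- The Hilbert space `G ⊗ ℂ^Ω` on which a sampler acts: the vector `ξ` stands for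
`∑ x, ξ x ⊗ |x⟩`. Here `G` is the (arbitrary) Hilbert space of the garbage register. -/
abbrev SampleSpace (Ω : Finset ℝ) (G : Type u) [NormedAddCommGroup G] [InnerProductSpace ℂ G] :
    Type u :=
  PiLp 2 (fun _ : Ω => G)

/-- The product vector `g ⊗ v` in `G ⊗ ℂ^Ω`. -/
noncomputable def productState {Ω : Finset ℝ} {G : Type u} [NormedAddCommGroup G]
    [InnerProductSpace ℂ G] (g : G) (v : EuclideanSpace ℂ Ω) : SampleSpace Ω G :=
  WithLp.toLp 2 (fun x => v x • g)

/-- The unitary `S` is a quantum sampler for the distribution `d` on `Ω`: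
`S (|0⟩|0⟩) = ∑ x, √(d x) |ψ x⟩|x⟩` for some unit vectors `ψ x`, where `g₀` and `o₀` are the fixed
initial vectors `|0⟩` of the garbage register and of the sample register. -/
def IsSampler {Ω : Finset ℝ} {G : Type u} [NormedAddCommGroup G] [InnerProductSpace ℂ G]
    (g₀ : G) (o₀ : EuclideanSpace ℂ Ω) (d : Ω → ℝ)
    (S : SampleSpace Ω G ≃ₗᵢ[ℂ] SampleSpace Ω G) : Prop :=
  ∃ ψ : Ω → G, (∀ x, ‖ψ x‖ = 1) ∧
    S (productState g₀ o₀) = WithLp.toLp 2 (fun x => ((Real.sqrt (d x) : ℝ) : ℂ) • ψ x)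

/-! ### Quantum algorithms with black-box access to a sampler -/

/-- The state space `ℂ^W ⊗ (G ⊗ ℂ^Ω)` of an algorithm with a finite workspace register `W`:
the vector `Ψ` stands for `∑ w, |w⟩ ⊗ Ψ w`. -/
abbrev StateSpace (Ω : Finset ℝ) (G : Type u) [NormedAddCommGroup G] [InnerProductSpace ℂ G]
    (W : Type) [Fintype W] : Type u :=
  PiLp 2 (fun _ : W => SampleSpace Ω G)

/-- The instructions of a classically controlled quantum algorithm, whose classical memory takes
its values in `M`. The last argument of each instruction is the next memory content. -/
inductive Instr (Ω : Finset ℝ) (G : Type u) [NormedAddCommGroup G] [InnerProductSpace ℂ G]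
    (W : Type) [Fintype W] (M : Type) : Type u
  /-- Stop and output `r`. -/
  | halt (r : ℝ) : Instr Ω G W M
  /-- Apply a unitary that does not involve the sampler. -/
  | gate (U : StateSpace Ω G W ≃ₗᵢ[ℂ] StateSpace Ω G W) (next : M) : Instr Ω G W M
  /-- One quantum sample: apply the sampler (or its inverse, if `inverse` holds), controlled on
  the workspace being in a basis state `w` with `ctrl w`. -/
  | query (inverse : Bool) (ctrl : W → Bool) (next : M) : Instr Ω G W M
  /-- Projective measurement of the value `f w` of the workspace register; the computation
  continues according to the outcome. -/
  | measure (k : ℕ) (f : W → Fin k) (next : Fin k → M) : Instr Ω G W M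
  /-- Discard all quantum registers and prepare them afresh in the initial state. -/
  | reset (next : M) : Instr Ω G W M

/-- A quantum algorithm using a sampler on `G ⊗ ℂ^Ω` as a black box: a finite workspace register,
a classical memory, and for every memory content the instruction to execute. -/
structure Algorithm (Ω : Finset ℝ) (G : Type u) [NormedAddCommGroup G]
    [InnerProductSpace ℂ G] where
  /-- basis states of the workspace register -/
  Work : Type
  [fintypeWork : Fintype Work]
  [decEqWork : DecidableEq Work]
  /-- contents of the classical memory -/
  Mem : Type
  /-- initial state of the workspace register -/
  work₀ : Work
  /-- initial content of the classical memory -/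
  mem₀ : Mem
  /-- the program -/
  instr : Mem → Instr Ω G Work Mem

attribute [instance] Algorithm.fintypeWork Algorithm.decEqWork

section Semantics

variable {Ω : Finset ℝ} {G : Type u} [NormedAddCommGroup G] [InnerProductSpace ℂ G]

/-- The (controlled) application of the sampler or of its inverse to the state `Ψ`. -/
noncomputable def applyQuery {W : Type} [Fintype W]
    (S : SampleSpace Ω G ≃ₗᵢ[ℂ] SampleSpace Ω G) (inverse : Bool) (ctrl : W → Bool)
    (Ψ : StateSpace Ω G W) : StateSpace Ω G W :=
  WithLp.toLp 2 (fun w =>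
    if ctrl w then (if inverse then S.symm (Ψ w) else S (Ψ w)) else Ψ w)

/-- The unnormalised state after the measurement of `f` has given the outcome `i`. -/
noncomputable def collapse {W : Type} [Fintype W] {k : ℕ} (f : W → Fin k) (i : Fin k)
    (Ψ : StateSpace Ω G W) : StateSpace Ω G W :=
  WithLp.toLp 2 (fun w => if f w = i then Ψ w else 0)

/-- The initial state `|w₀⟩ ⊗ |0⟩|0⟩`. -/
noncomputable def Algorithm.initState (A : Algorithm Ω G) (g₀ : G) (o₀ : EuclideanSpace ℂ Ω) :
    StateSpace Ω G A.Work :=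
  WithLp.toLp 2 (fun w => if w = A.work₀ then productState g₀ o₀ else 0)

/-- The probability weight with which the algorithm, started with memory content `m` in the
unnormalised state `Ψ` (whose squared norm is the probability of the current branch), halts within
`n` instructions with an output in `T`. -/
noncomputable def Algorithm.outputWeight (A : Algorithm Ω G) (g₀ : G) (o₀ : EuclideanSpace ℂ Ω)
    (S : SampleSpace Ω G ≃ₗᵢ[ℂ] SampleSpace Ω G) (T : Set ℝ) :
    ℕ → A.Mem → StateSpace Ω G A.Work → ℝ≥0∞
  | 0, _, _ => 0
  | n + 1, m, Ψ =>
    match A.instr m with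
    | .halt r => T.indicator (fun _ => ENNReal.ofReal (‖Ψ‖ ^ 2)) r
    | .gate U next => A.outputWeight g₀ o₀ S T n next (U Ψ)
    | .query inverse ctrl next =>
        A.outputWeight g₀ o₀ S T n next (applyQuery S inverse ctrl Ψ)
    | .measure k f next =>
        ∑ i : Fin k, A.outputWeight g₀ o₀ S T n (next i) (collapse f i Ψ)
    | .reset next =>
        A.outputWeight g₀ o₀ S T n next ((‖Ψ‖ : ℂ) • A.initState g₀ o₀)

/-- The contribution to the expected number of quantum samples of the first `n` instructions
executed from memory content `m` and unnormalised state `Ψ`. -/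
noncomputable def Algorithm.queryWeight (A : Algorithm Ω G) (g₀ : G) (o₀ : EuclideanSpace ℂ Ω)
    (S : SampleSpace Ω G ≃ₗᵢ[ℂ] SampleSpace Ω G) :
    ℕ → A.Mem → StateSpace Ω G A.Work → ℝ≥0∞
  | 0, _, _ => 0
  | n + 1, m, Ψ =>
    match A.instr m with
    | .halt _ => 0
    | .gate U next => A.queryWeight g₀ o₀ S n next (U Ψ)
    | .query inverse ctrl next =>
        ENNReal.ofReal (‖Ψ‖ ^ 2) +
          A.queryWeight g₀ o₀ S n next (applyQuery S inverse ctrl Ψ)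
    | .measure k f next =>
        ∑ i : Fin k, A.queryWeight g₀ o₀ S n (next i) (collapse f i Ψ)
    | .reset next =>
        A.queryWeight g₀ o₀ S n next ((‖Ψ‖ : ℂ) • A.initState g₀ o₀)

/-- The probability that the algorithm halts with an output in `T`. -/
noncomputable def Algorithm.outputProb (A : Algorithm Ω G) (g₀ : G) (o₀ : EuclideanSpace ℂ Ω)
    (S : SampleSpace Ω G ≃ₗᵢ[ℂ] SampleSpace Ω G) (T : Set ℝ) : ℝ≥0∞ :=
  ⨆ n : ℕ, A.outputWeight g₀ o₀ S T n A.mem₀ (A.initState g₀ o₀)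

/-- The expected number of quantum samples used by the algorithm. -/
noncomputable def Algorithm.expectedSamples (A : Algorithm Ω G) (g₀ : G)
    (o₀ : EuclideanSpace ℂ Ω) (S : SampleSpace Ω G ≃ₗᵢ[ℂ] SampleSpace Ω G) : ℝ≥0∞ :=
  ⨆ n : ℕ, A.queryWeight g₀ o₀ S n A.mem₀ (A.initState g₀ o₀)

end Semantics

end QuantumSampling

/-!
The algorithm uses only Grover iterations, measurements and classical post-processing; no phase
estimation is involved.

*Amplitude estimation.* For `f : Ω → [0, 1]`, one application of the sampler followed by a rotation
of an ancilla qubit by the angle `arcsin √(f x)` prepares a state in which the ancilla reads `1`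
with probability `𝔼 f = sin² θ`. After `m` Grover iterations, at the price of `2 m + 1` quantum
samples, this probability is `sin² ((2 m + 1) θ)` (`norm_collapse_execute_circuit`). The frequencies
for `m` in the set `{0, 2 ^ a, 2 ^ a + 2 ^ b : a, b ≤ n}`, each known up to the error `1 / 128`,
determine `θ ∈ [0, π / 2]` up to `2 ^ (-n)`: by
`sin² (K x) - sin² (K y) = sin (K (x + y)) sin (K (x - y))` two candidates `x`, `y` are
distinguished by some `K = 2 m + 1` of size about `1 / |x - y|`, since `sin (K (x + y))` cannot be
small at all those `K` at once: powers of two occur as their differences, and an angle whose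
doublings up to the scale `K` all have a small sine is very close to a multiple of `π`
(`abs_sub_le_of_sin_sq_close`).
With Chernoff's bound, `θ` is found up to `2 ^ (-n)` with `O(2 ^ n)` samples, up to logarithmic
factors (`failProb_estimateAngle_le`).

*Search for the scale.* For `b = 2 Δ² H / 2 ^ j`, `j = 0, 1, 2, …`, the algorithm tests with `O(Δ)`
samples whether `𝔼 min (X / b) 1` is at least of the order `1 / Δ²`. This expectation is at most
`μ / b`, is antitone in `b`, and is at least `1 / (4 Δ²)` once `b ≤ 2 Δ² μ`, because
`𝔼 (X - min X b) ≤ φ² / b`. Hence the first accepted `b` is of the order of `Δ² μ`, and *every*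
later test accepts with probability at least `1 / 2`: the search stops almost surely, and its expected
cost is bounded without any lower bound on `μ` (`Setting.runSamples_le`). The `j`-th test fails with
probability at most `δ / 8 / 2 ^ j`, so that all errors sum up to at most `δ`.

*Estimate at the right scale.* Given `b` of the order of `Δ² μ`, the variable `min X (b 2 ^ L)` with
`2 ^ L` of the order of `1 / ε` has mean `(1 ± ε / 4) μ` and is a sum of `L + 1` dyadic layers
`b 2 ^ l f_l` with `f_l` in `[0, 1]`. The second moment bounds `b 2 ^ l √(𝔼 f_l)` by `8 Δ μ`, so an
error `e` of the angle contributes only `O(Δ μ e + b 2 ^ l e²)`, and `e` of the order of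
`ε / (Δ (L + 1))` suffices (`layer_error_le`).

The quantum semantics is reduced to the classical analysis by writing the algorithm as a sequence of
classical decision trees of Bernoulli experiments (`Protocol`), each experiment being one Grover
circuit on freshly prepared registers (`runWeight_fresh`, `runSamples_fresh`).
-/

namespace QuantumSampling

/-! ### Adaptive protocols of Bernoulli experiments -/

/-- A finite adaptive protocol: a decision tree whose inner nodes run an experiment with a binary
outcome, labelled by an element of `E`, and whose leaves carry the result. -/
inductive Protocol (E α : Type) : Type
  | ret (a : α) : Protocol E α
  | run (e : E) (k : Bool → Protocol E α) : Protocol E α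

namespace Protocol

variable {E α β : Type}

/-- Sequential composition of protocols. -/
def bind : Protocol E α → (α → Protocol E β) → Protocol E β
  | ret a, f => f a
  | run e k, f => run e (fun b => (k b).bind f)

/-- The expectation of the total cost of the experiments that are run plus `F` of the result, when
the experiment `e` succeeds with probability `p e` and costs `c e`. With `c = 0` this is the
expectation of `F`. -/
noncomputable def expect (c : E → ℝ≥0∞) (p : E → ℝ) :
    Protocol E α → (α → ℝ≥0∞) → ℝ≥0∞
  | ret a, F => F a
  | run e k, F => c e + (ENNReal.ofReal (1 - p e) * (k false).expect c p F +
      ENNReal.ofReal (p e) * (k true).expect c p F)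

/-- The largest possible cost of a run of the protocol. -/
noncomputable def maxCost (c : E → ℝ≥0∞) : Protocol E α → ℝ≥0∞
  | ret _ => 0
  | run e k => c e + max ((k false).maxCost c) ((k true).maxCost c)

theorem expect_bind (c : E → ℝ≥0∞) (p : E → ℝ) (t : Protocol E α) (f : α → Protocol E β)
    (F : β → ℝ≥0∞) :
    (t.bind f).expect c p F = t.expect c p (fun a => (f a).expect c p F) := by
  induction t with
  | ret a => rfl
  | run e k ih => simp only [bind, expect, ih]

theorem expect_mono (c : E → ℝ≥0∞) (p : E → ℝ) (t : Protocol E α) {F F' : α → ℝ≥0∞}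
    (h : ∀ a, F a ≤ F' a) : t.expect c p F ≤ t.expect c p F' := by
  induction t with
  | ret a => exact h a
  | run e k ih => simp only [expect]; gcongr <;> apply ih

theorem maxCost_bind_le (c : E → ℝ≥0∞) (t : Protocol E α) (f : α → Protocol E β) {B : ℝ≥0∞}
    (h : ∀ a, (f a).maxCost c ≤ B) : (t.bind f).maxCost c ≤ t.maxCost c + B := by
  induction t with
  | ret a => simpa [bind, maxCost] using h a
  | run e k ih =>
    simp only [bind, maxCost]
    rw [add_assoc]
    gcongr
    exact max_le ((ih false).trans (by gcongr; exact le_max_left _ _))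
      ((ih true).trans (by gcongr; exact le_max_right _ _))

section Probability

variable {p : E → ℝ} (hp : ∀ e, 0 ≤ p e ∧ p e ≤ 1)

include hp

theorem ofReal_one_sub_add_ofReal (e : E) :
    ENNReal.ofReal (1 - p e) + ENNReal.ofReal (p e) = 1 := by
  rw [← ENNReal.ofReal_add (by linarith [(hp e).2]) (hp e).1]; simp

theorem expect_const (t : Protocol E α) (v : ℝ≥0∞) : t.expect 0 p (fun _ => v) = v := by
  induction t with
  | ret a => rfl
  | run e k ih =>
    simp only [expect, ih, ← add_mul, ofReal_one_sub_add_ofReal hp]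
    simp

omit hp in
theorem expect_add (t : Protocol E α) (F F' : α → ℝ≥0∞) :
    t.expect 0 p (fun a => F a + F' a) = t.expect 0 p F + t.expect 0 p F' := by
  induction t with
  | ret a => rfl
  | run e k ih => simp only [expect, ih, Pi.zero_apply, zero_add]; ring

omit hp in
theorem expect_const_mul (t : Protocol E α) (v : ℝ≥0∞) (F : α → ℝ≥0∞) :
    t.expect 0 p (fun a => v * F a) = v * t.expect 0 p F := by
  induction t with
  | ret a => rfl
  | run e k ih => simp only [expect, ih, Pi.zero_apply, zero_add]; ring

theorem expect_le_maxCost_add (c : E → ℝ≥0∞) (t : Protocol E α) (F : α → ℝ≥0∞) :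
    t.expect c p F ≤ t.maxCost c + t.expect 0 p F := by
  induction t with
  | ret a => simp [expect, maxCost]
  | run e k ih =>
    simp only [expect, maxCost, Pi.zero_apply, zero_add]
    rw [add_assoc]
    refine add_le_add le_rfl ?_
    set M := max ((k false).maxCost c) ((k true).maxCost c)
    calc _ ≤ ENNReal.ofReal (1 - p e) * (M + (k false).expect 0 p F) +
          ENNReal.ofReal (p e) * (M + (k true).expect 0 p F) := by
          gcongr
          · exact (ih false).trans (by gcongr; exact le_max_left _ _)
          · exact (ih true).trans (by gcongr; exact le_max_right _ _)
      _ = (ENNReal.ofReal (1 - p e) + ENNReal.ofReal (p e)) * M +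
          (ENNReal.ofReal (1 - p e) * (k false).expect 0 p F +
          ENNReal.ofReal (p e) * (k true).expect 0 p F) := by ring
      _ = _ := by rw [ofReal_one_sub_add_ofReal hp, one_mul]

end Probability

open Classical in
/-- The probability that the result of the protocol violates `S`. -/
noncomputable def failProb (p : E → ℝ) (t : Protocol E α) (S : α → Prop) : ℝ≥0∞ :=
  t.expect 0 p (fun a => if S a then 0 else 1)

section FailProb

variable {p : E → ℝ}

theorem failProb_mono (t : Protocol E α) {S S' : α → Prop} (h : ∀ a, S a → S' a) :
    t.failProb p S' ≤ t.failProb p S := by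
  classical
  refine expect_mono _ _ _ fun a => ?_
  by_cases h1 : S a
  · simp [h1, h a h1]
  · simp only [h1, if_false]; split_ifs <;> simp

theorem failProb_and_le (t : Protocol E α) (S S' : α → Prop) :
    t.failProb p (fun a => S a ∧ S' a) ≤ t.failProb p S + t.failProb p S' := by
  classical
  rw [failProb, failProb, failProb, ← expect_add]
  refine expect_mono _ _ _ fun a => ?_
  by_cases h1 : S a <;> by_cases h2 : S' a <;> simp [h1, h2]

variable (hp : ∀ e, 0 ≤ p e ∧ p e ≤ 1)
include hp

/-- A lower bound for an expectation, with additive errors: `x` on good results, and at most `z`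
more on bad results, which have probability at most `y`. -/
theorem one_le_expect_add (t : Protocol E α) {F : α → ℝ≥0∞} {S : α → Prop} {x y z : ℝ≥0∞}
    (hS : ∀ a, S a → 1 ≤ F a + x) (hF : ∀ a, 1 ≤ F a + x + z) (hy : t.failProb p S ≤ y) :
    1 ≤ t.expect 0 p F + x + z * y := by
  classical
  calc (1 : ℝ≥0∞) = t.expect 0 p (fun _ => 1) := (expect_const hp t 1).symm
    _ ≤ t.expect 0 p (fun a => (F a + x) + z * (if S a then 0 else 1)) := by
        refine expect_mono _ _ _ fun a => ?_
        by_cases h : S a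
        · simpa [h] using hS a h
        · simpa [h] using hF a
    _ = t.expect 0 p F + x + z * t.failProb p S := by
        rw [expect_add, expect_add, expect_const hp, expect_const_mul, failProb]
    _ ≤ _ := by gcongr

/-- The upper bound corresponding to `one_le_expect_add`. -/
theorem expect_le_add_mul_failProb (t : Protocol E α) {F : α → ℝ≥0∞} {S : α → Prop}
    {x z : ℝ≥0∞} (hS : ∀ a, S a → F a ≤ x) (hF : ∀ a, F a ≤ x + z) :
    t.expect 0 p F ≤ x + z * t.failProb p S := by
  classical
  calc t.expect 0 p F ≤ t.expect 0 p (fun a => x + z * (if S a then 0 else 1)) := by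
        refine expect_mono _ _ _ fun a => ?_
        by_cases h : S a
        · simpa [h] using hS a h
        · simpa [h] using hF a
    _ = x + z * t.failProb p S := by
        rw [expect_add, expect_const hp, expect_const_mul, failProb]

theorem failProb_bind_le (t : Protocol E α) (f : α → Protocol E β) {S : α → Prop} {S' : β → Prop}
    {x y : ℝ≥0∞} (h : ∀ a, S a → (f a).failProb p S' ≤ x) (ht : t.failProb p S ≤ y) :
    (t.bind f).failProb p S' ≤ x + y := by
  classical
  have h1 : ∀ a, (f a).failProb p S' ≤ 1 := fun a => by
    calc _ ≤ (f a).expect 0 p (fun _ => 1) := by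
          refine expect_mono _ _ _ fun a => ?_
          split_ifs <;> simp
      _ = 1 := expect_const hp _ _
  rw [failProb, expect_bind]
  calc _ ≤ x + 1 * t.failProb p S :=
        expect_le_add_mul_failProb hp t h (fun a => (h1 a).trans le_add_self)
    _ ≤ _ := by rw [one_mul]; gcongr

end FailProb

/-! ### Repeated experiments and Chernoff's bound -/

/-- The protocol that runs the experiment `e` `N` times and returns `s` plus the number of
successes. -/
def count (e : E) : ℕ → ℕ → Protocol E ℕ
  | 0, s => ret s
  | N + 1, s => run e (fun b => count e N (s + b.toNat))

theorem maxCost_count (c : E → ℝ≥0∞) (e : E) (N s : ℕ) :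
    (count e N s).maxCost c = N * c e := by
  induction N generalizing s with
  | zero => simp [count, maxCost]
  | succ N ih => simp only [count, maxCost, ih, max_self]; push_cast; ring

section Chernoff

variable {p : E → ℝ} (hp : ∀ e, 0 ≤ p e ∧ p e ≤ 1)
include hp

/-- The moment generating function of the binomial distribution. -/
theorem expect_count_exp (e : E) (N s : ℕ) (x : ℝ) :
    (count e N s).expect 0 p (fun n => ENNReal.ofReal (Real.exp (x * n))) =
      ENNReal.ofReal (Real.exp (x * s) * (1 - p e + p e * Real.exp x) ^ N) := by
  have h0 := (hp e).1
  have h1 : 0 ≤ 1 - p e := by linarith [(hp e).2]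
  induction N generalizing s with
  | zero => simp [count, expect]
  | succ N ih =>
    simp only [count, expect, ih, Pi.zero_apply, zero_add]
    rw [← ENNReal.ofReal_mul h1, ← ENNReal.ofReal_mul h0, ← ENNReal.ofReal_add]
    · congr 1
      have : Real.exp (x * ((s + 1 : ℕ) : ℝ)) = Real.exp (x * s) * Real.exp x := by
        rw [← Real.exp_add]; push_cast; ring_nf
      simp only [Bool.toNat_false, Bool.toNat_true, this, add_zero]
      ring
    · positivity
    · positivity

omit hp in
theorem exp_le_one_add_add_sq {x : ℝ} (hx : |x| ≤ 1) : Real.exp x ≤ 1 + x + x ^ 2 := by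
  have := (abs_le.1 (Real.abs_exp_sub_one_sub_id_le hx)).2
  linarith

/-- The exponential Markov inequality; the sign of `x` selects the upper or the lower tail. -/
theorem failProb_count_exp_le (e : E) (N : ℕ) {x η : ℝ} (hx : |x| ≤ 1) :
    (count e N 0).failProb p (fun n => x * n ≤ N * (x * p e + η)) ≤
      ENNReal.ofReal (Real.exp (N * (x ^ 2 - η))) := by
  classical
  have h0 := (hp e).1
  have h1 := (hp e).2
  have key : (1 - p e + p e * Real.exp x) ^ N ≤ Real.exp (N * (x * p e + x ^ 2)) := by
    rw [Real.exp_nat_mul]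
    apply pow_le_pow_left₀ (by nlinarith [Real.exp_pos x])
    calc 1 - p e + p e * Real.exp x ≤ 1 - p e + p e * (1 + x + x ^ 2) := by
          gcongr; exact exp_le_one_add_add_sq hx
      _ ≤ (x * p e + x ^ 2) + 1 := by nlinarith [sq_nonneg x]
      _ ≤ _ := Real.add_one_le_exp _
  calc (count e N 0).failProb p (fun n => x * n ≤ N * (x * p e + η))
      ≤ (count e N 0).expect 0 p (fun n => ENNReal.ofReal (Real.exp (-(N * (x * p e + η)))) *
          ENNReal.ofReal (Real.exp (x * n))) := by
        refine expect_mono _ _ _ fun n => ?_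
        split_ifs with h
        · simp
        · rw [← ENNReal.ofReal_mul (by positivity), ← Real.exp_add, ← ENNReal.ofReal_one]
          apply ENNReal.ofReal_le_ofReal
          rw [Real.one_le_exp_iff]
          push Not at h
          linarith
    _ = ENNReal.ofReal (Real.exp (-(N * (x * p e + η))) *
          (1 - p e + p e * Real.exp x) ^ N) := by
        rw [expect_const_mul, expect_count_exp hp, ← ENNReal.ofReal_mul (by positivity)]
        simp
    _ ≤ ENNReal.ofReal (Real.exp (-(N * (x * p e + η))) *
          Real.exp (N * (x * p e + x ^ 2))) := by gcongr
    _ = _ := by rw [← Real.exp_add]; ring_nf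

/-- Chernoff's bound, with a constant that is convenient rather than optimal. -/
theorem failProb_count_le (e : E) {N : ℕ} (hN : 0 < N) {η : ℝ} (hη : 0 < η) (hη1 : η ≤ 1) :
    (count e N 0).failProb p (fun n => |(n : ℝ) / N - p e| ≤ η) ≤
      ENNReal.ofReal (2 * Real.exp (-(N * η ^ 2 / 4))) := by
  have hN' : (0 : ℝ) < N := by exact_mod_cast hN
  have hx : |η / 2| ≤ 1 := by rw [abs_of_pos (by positivity)]; linarith
  have hx' : |-(η / 2)| ≤ 1 := by rwa [abs_neg]
  calc _ ≤ (count e N 0).failProb p (fun n => (η / 2 * n ≤ N * (η / 2 * p e + η ^ 2 / 2)) ∧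
          (-(η / 2) * n ≤ N * (-(η / 2) * p e + η ^ 2 / 2))) := by
        refine failProb_mono _ fun n h => ?_
        have h1 : η / 2 * (n : ℝ) ≤ η / 2 * (N * (p e + η)) := by linarith [h.1]
        have h2 : η / 2 * (N * (p e - η)) ≤ η / 2 * (n : ℝ) := by linarith [h.2]
        have h1 := le_of_mul_le_mul_left h1 (by positivity)
        have h2 := le_of_mul_le_mul_left h2 (by positivity)
        rw [abs_le, neg_le_sub_iff_le_add, sub_le_iff_le_add, div_le_iff₀ hN',
          ← sub_le_iff_le_add, le_div_iff₀ hN']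
        constructor <;> linarith
    _ ≤ ENNReal.ofReal (Real.exp (N * ((η / 2) ^ 2 - η ^ 2 / 2))) +
          ENNReal.ofReal (Real.exp (N * ((-(η / 2)) ^ 2 - η ^ 2 / 2))) :=
        (failProb_and_le _ _ _).trans
          (add_le_add (failProb_count_exp_le hp e N hx) (failProb_count_exp_le hp e N hx'))
    _ = _ := by
        rw [← ENNReal.ofReal_add (by positivity) (by positivity)]
        ring_nf

end Chernoff

end Protocol

/-! ### An angle is determined by its Grover frequencies at all scales -/

theorem sin_sq_sub_sin_sq (x y : ℝ) :
    Real.sin x ^ 2 - Real.sin y ^ 2 = Real.sin (x + y) * Real.sin (x - y) := by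
  rw [Real.sin_add, Real.sin_sub]
  linear_combination (Real.sin y ^ 2) * Real.sin_sq_add_cos_sq x -
    (Real.sin x ^ 2) * Real.sin_sq_add_cos_sq y

theorem abs_sin_sub_le (x y : ℝ) :
    |Real.sin (x - y)| ≤ |Real.sin x| + |Real.sin y| := by
  rw [Real.sin_sub]
  refine (abs_sub _ _).trans ?_
  rw [abs_mul, abs_mul]
  nlinarith [Real.abs_cos_le_one x, Real.abs_cos_le_one y, abs_nonneg (Real.sin x),
    abs_nonneg (Real.sin y)]

theorem quarter_le_sin {x : ℝ} (h1 : Real.pi / 8 ≤ x) (h2 : x ≤ 7 * Real.pi / 8) :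
    1 / 4 ≤ Real.sin x := by
  have hpi := Real.pi_pos
  have key : ∀ y : ℝ, Real.pi / 8 ≤ y → y ≤ Real.pi / 2 → 1 / 4 ≤ Real.sin y := fun y h h' => by
    refine le_trans ?_ (Real.mul_le_sin (by linarith) h')
    rw [div_mul_eq_mul_div, le_div_iff₀ hpi]
    linarith
  rcases le_total x (Real.pi / 2) with h | h
  · exact key x h1 h
  · rw [← Real.sin_pi_sub]
    exact key _ (by linarith) (by linarith)

/-- If the sines of `w, 2 w, …, 2 ^ n w` are all small, then no doubling leaves the first quadrant,
and so even `2 ^ n w` is small. -/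
theorem two_pow_mul_le_of_sin_le {w s : ℝ} (hs : s ≤ 1 / 2) (hw0 : 0 ≤ w)
    (hw : w ≤ Real.pi / 2) (n : ℕ) (h : ∀ i ≤ n, |Real.sin (2 ^ i * w)| ≤ s) :
    2 ^ n * w ≤ Real.pi / 2 * s := by
  have hpi := Real.pi_pos
  have key : ∀ y : ℝ, 0 ≤ y → y ≤ Real.pi / 2 → |Real.sin y| ≤ s → y ≤ Real.pi / 2 * s := by
    intro y h0 h1 h2
    have h3 := (Real.mul_le_sin h0 h1).trans ((le_abs_self _).trans h2)
    rw [div_mul_eq_mul_div, div_le_iff₀ hpi] at h3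
    linarith
  induction n with
  | zero => exact key _ (by simpa using hw0) (by simpa using hw) (h 0 le_rfl)
  | succ n ih =>
    have h1 := ih fun i hi => h i (by omega)
    refine key _ (by positivity) ?_ (h _ le_rfl)
    rw [pow_succ]
    nlinarith

/-- The numbers of Grover iterations `0`, `2 ^ a` and `2 ^ a + 2 ^ b` with `a, b ≤ n`, at which the
success frequencies are sampled. The corresponding multiples `2 m + 1` of the angle include pairs
at distance `2 ^ (b + 1)` at every scale `2 ^ (a + 1)`. -/
def iterationCounts (n : ℕ) : List ℕ :=
  0 :: ((List.range (n + 1)).map (fun a => 2 ^ a) ++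
    (List.range (n + 1) ×ˢ List.range (n + 1)).map (fun ab => 2 ^ ab.1 + 2 ^ ab.2))

theorem zero_mem_iterationCounts (n : ℕ) : 0 ∈ iterationCounts n := by simp [iterationCounts]

theorem two_pow_mem_iterationCounts {n a : ℕ} (ha : a ≤ n) : 2 ^ a ∈ iterationCounts n := by
  simp only [iterationCounts, List.mem_cons, List.mem_append, List.mem_map, List.mem_range]
  exact Or.inr (Or.inl ⟨a, by omega, rfl⟩)

theorem two_pow_add_mem_iterationCounts {n a b : ℕ} (ha : a ≤ n) (hb : b ≤ n) :
    2 ^ a + 2 ^ b ∈ iterationCounts n := by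
  simp only [iterationCounts, List.mem_cons, List.mem_append, List.mem_map]
  refine Or.inr (Or.inr ⟨(a, b), ?_, rfl⟩)
  rw [List.mem_product]
  simp only [List.mem_range]
  omega

theorem length_iterationCounts (n : ℕ) : (iterationCounts n).length ≤ (n + 2) ^ 2 := by
  simp only [iterationCounts, List.length_cons, List.length_append, List.length_map,
    List.length_range, List.length_product]
  nlinarith

theorem le_of_mem_iterationCounts {n m : ℕ} (h : m ∈ iterationCounts n) : m ≤ 2 ^ (n + 1) := by
  have key : ∀ a < n + 1, 2 ^ a ≤ 2 ^ n := fun a ha => Nat.pow_le_pow_right (by norm_num) (by omega)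
  simp only [iterationCounts, List.mem_cons, List.mem_append, List.mem_map] at h
  rcases h with rfl | ⟨a, ha, rfl⟩ | ⟨⟨a, b⟩, hab, rfl⟩
  · positivity
  · have := key a (by simpa using ha)
    rw [pow_succ]; omega
  · rw [List.mem_product] at hab
    have h1 := key a (by simpa using hab.1)
    have h2 := key b (by simpa using hab.2)
    rw [pow_succ]; dsimp only; omega

/-- Approximate injectivity: the numbers `sin² ((2 m + 1) x)` determine `x`. With `u = x - y` and
`v = x + y` every `sin ((2 m + 1) u) sin ((2 m + 1) v)` is small. At the scale at which `u` becomes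
visible the first factor is not small, so all second factors are, and with them the sines of
`v, 2 v, 4 v, …`. Then `v` or `π - v` is smaller than `u`, which is impossible. -/
theorem sub_le_of_sin_sq_close {n : ℕ} {x y : ℝ} (hy0 : 0 ≤ y)
    (hx1 : x ≤ Real.pi / 2) (hyx : y ≤ x)
    (h : ∀ m ∈ iterationCounts n,
      |Real.sin ((2 * m + 1) * x) ^ 2 - Real.sin ((2 * m + 1) * y) ^ 2| ≤ 1 / 64) :
    x - y ≤ 1 / 2 ^ n := by
  have hpi := Real.pi_pos
  have hpi4 := Real.pi_lt_four
  set u := x - y with hu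
  set v := x + y with hv
  have hu0 : 0 ≤ u := by linarith
  have huv : u ≤ v := by linarith
  have hvu : v ≤ Real.pi - u := by linarith
  have h' : ∀ m ∈ iterationCounts n,
      |Real.sin ((2 * m + 1) * v)| * |Real.sin ((2 * m + 1) * u)| ≤ 1 / 64 := by
    intro m hm
    have := h m hm
    rw [sin_sq_sub_sin_sq, abs_mul] at this
    rwa [hv, hu, mul_add, mul_sub]
  have hu1 : u < Real.pi / 8 := by
    by_contra! hc
    have h0 := h' 0 (zero_mem_iterationCounts n)
    simp only [Nat.cast_zero, mul_zero, zero_add, one_mul] at h0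
    have a1 := (quarter_le_sin hc (by linarith)).trans (le_abs_self _)
    have a2 := (quarter_le_sin (hc.trans huv) (by linarith)).trans (le_abs_self _)
    nlinarith
  by_contra! hc
  have hlarge : Real.pi / 8 ≤ 2 ^ (n + 1) * u := by
    have : 1 < 2 ^ n * u := by
      rw [div_lt_iff₀ (by positivity)] at hc; linarith
    rw [pow_succ]; linarith
  -- the first scale `2 ^ (a + 1)` at which `u` becomes visible
  obtain ⟨a, han, ha1, ha2⟩ : ∃ a ≤ n, Real.pi / 8 ≤ 2 ^ (a + 1) * u ∧
      2 ^ (a + 1) * u < Real.pi / 4 := by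
    classical
    have hex : ∃ a, Real.pi / 8 ≤ 2 ^ (a + 1) * u := ⟨n, hlarge⟩
    refine ⟨Nat.find hex, Nat.find_le hlarge, Nat.find_spec hex, ?_⟩
    rcases hf : Nat.find hex with _ | a
    · simp only [zero_add, pow_one]; linarith
    · have := Nat.find_min hex (m := a) (by omega)
      push Not at this
      rw [pow_succ]; linarith
  -- at this scale `sin ((2 * m + 1) * u)` is at least `1 / 4`
  have hsinv : ∀ m ∈ iterationCounts n, 2 ^ a ≤ m → m ≤ 2 ^ (a + 1) →
      |Real.sin ((2 * m + 1) * v)| ≤ 1 / 16 := by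
    intro m hm h1 h2
    have h1' : (2 : ℝ) ^ a ≤ m := by exact_mod_cast h1
    have h2' : (m : ℝ) ≤ 2 ^ (a + 1) := by exact_mod_cast h2
    have h1a : (1 : ℝ) ≤ 2 ^ a := one_le_pow₀ (by norm_num)
    have hk := h' m hm
    rw [pow_succ] at ha1 ha2 h2'
    have a1 := (quarter_le_sin (x := (2 * m + 1) * u) (by nlinarith) (by nlinarith)).trans
      (le_abs_self _)
    nlinarith [abs_nonneg (Real.sin ((2 * m + 1) * v))]
  have hbase := hsinv _ (two_pow_mem_iterationCounts han) le_rfl (by rw [pow_succ]; omega)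
  push_cast at hbase
  have hdiff : ∀ b ≤ a, |Real.sin (2 ^ (b + 1) * v)| ≤ 1 / 8 := by
    intro b hb
    have hb' : 2 ^ b ≤ 2 ^ a := Nat.pow_le_pow_right (by norm_num) hb
    have h1 := hsinv _ (two_pow_add_mem_iterationCounts han (hb.trans han))
      (Nat.le_add_right _ _) (by rw [pow_succ]; omega)
    push_cast at h1
    have : 2 ^ (b + 1) * v = (2 * (2 ^ a + 2 ^ b) + 1) * v - (2 * 2 ^ a + 1) * v := by ring
    rw [this]
    exact (abs_sin_sub_le _ _).trans (by linarith)
  -- `1` is the difference of the odd number `2 ^ (a + 1) + 1` and of `2 ^ (a + 1)`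
  have hone : |Real.sin v| ≤ 3 / 16 := by
    have : v = (2 * 2 ^ a + 1) * v - 2 ^ (a + 1) * v := by ring
    rw [this]
    exact (abs_sin_sub_le _ _).trans (by linarith [hdiff a le_rfl])
  have hall : ∀ i ≤ a + 1, |Real.sin (2 ^ i * v)| ≤ 3 / 16 := by
    rintro (_ | i) hi
    · simpa using hone
    · exact (hdiff i (by omega)).trans (by norm_num)
  obtain ⟨w, hw0, hw1, huw, hw⟩ : ∃ w, 0 ≤ w ∧ w ≤ Real.pi / 2 ∧ u ≤ w ∧
      ∀ i ≤ a + 1, |Real.sin (2 ^ i * w)| ≤ 3 / 16 := by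
    rcases le_total v (Real.pi / 2) with hv2 | hv2
    · exact ⟨v, by linarith, hv2, huv, hall⟩
    · refine ⟨Real.pi - v, by linarith, by linarith, by linarith, fun i hi => ?_⟩
      have : (2 : ℝ) ^ i * (Real.pi - v) = ((2 ^ i : ℕ) : ℝ) * Real.pi - 2 ^ i * v := by
        push_cast; ring
      rw [this, Real.sin_nat_mul_pi_sub, abs_neg, abs_mul, abs_pow, abs_neg, abs_one, one_pow,
        one_mul]
      exact hall i hi
  have := two_pow_mul_le_of_sin_le (by norm_num) hw0 hw1 (a + 1) hw
  have h3 : (2 : ℝ) ^ (a + 1) * u ≤ 2 ^ (a + 1) * w := by gcongr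
  linarith

theorem abs_sub_le_of_sin_sq_close {n : ℕ} {x y : ℝ} (hx0 : 0 ≤ x) (hx1 : x ≤ Real.pi / 2)
    (hy0 : 0 ≤ y) (hy1 : y ≤ Real.pi / 2)
    (h : ∀ m ∈ iterationCounts n,
      |Real.sin ((2 * m + 1) * x) ^ 2 - Real.sin ((2 * m + 1) * y) ^ 2| ≤ 1 / 64) :
    |x - y| ≤ 1 / 2 ^ n := by
  rcases le_total y x with hyx | hxy
  · rw [abs_of_nonneg (by linarith)]
    exact sub_le_of_sin_sq_close hy0 hx1 hyx h
  · rw [abs_sub_comm, abs_of_nonneg (by linarith)]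
    refine sub_le_of_sin_sq_close hx0 hy1 hxy fun m hm => ?_
    rw [abs_sub_comm]
    exact h m hm

/-! ### Grover iteration -/

section Grover

variable {V : Type*} [AddCommGroup V] [Module ℂ V]

/-- Powers of a rotation by `2 θ`, in coordinates with respect to the (unnormalised, possibly
vanishing) good and bad parts `ψ₁`, `ψ₀` of the prepared state. The coordinates are described
without division, so that `sin θ = 0` and `cos θ = 0` need no special treatment. -/
theorem exists_iterate_eq_of_rotation {ψ₁ ψ₀ : V} {θ : ℝ} {D : V → V}
    (hD : ∀ x y : ℝ, D ((x : ℂ) • ψ₁ + (y : ℂ) • ψ₀) =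
      ((2 * (y * Real.cos θ ^ 2 - x * Real.sin θ ^ 2) + x : ℝ) : ℂ) • ψ₁ +
      ((2 * (y * Real.cos θ ^ 2 - x * Real.sin θ ^ 2) - y : ℝ) : ℂ) • ψ₀) (m : ℕ) :
    ∃ x y : ℝ, D^[m] (ψ₁ + ψ₀) = (x : ℂ) • ψ₁ + (y : ℂ) • ψ₀ ∧
      x * Real.sin θ = Real.sin ((2 * m + 1) * θ) ∧
      y * Real.cos θ = Real.cos ((2 * m + 1) * θ) := by
  induction m with
  | zero => exact ⟨1, 1, by simp, by simp, by simp⟩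
  | succ m ih =>
    obtain ⟨x, y, h, hx, hy⟩ := ih
    refine ⟨_, _, by rw [Function.iterate_succ_apply', h, hD], ?_, ?_⟩
    · have : ((2 * ((m + 1 : ℕ) : ℝ) + 1) * θ) = (2 * m + 1) * θ + 2 * θ := by push_cast; ring
      rw [this, Real.sin_add, ← hx, ← hy, Real.sin_two_mul, Real.cos_two_mul]
      linear_combination (-2 * x * Real.sin θ) * Real.sin_sq_add_cos_sq θ
    · have : ((2 * ((m + 1 : ℕ) : ℝ) + 1) * θ) = (2 * m + 1) * θ + 2 * θ := by push_cast; ring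
      rw [this, Real.cos_add, ← hx, ← hy, Real.sin_two_mul, Real.cos_two_mul]
      ring

end Grover

section Reflection

variable {V : Type*} [NormedAddCommGroup V] [InnerProductSpace ℂ V]

/-- The reflection `2|v⟩⟨v| - 1` for a unit vector `v`. -/
noncomputable def reflectAcross (v : V) : V ≃ₗᵢ[ℂ] V := (ℂ ∙ v).reflection

theorem reflectAcross_apply {v : V} (hv : ‖v‖ = 1) (w : V) :
    reflectAcross v w = (2 * inner ℂ v w) • v - w := by
  rw [reflectAcross, Submodule.reflection_singleton_apply, hv, two_smul, two_mul, add_smul]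
  simp

end Reflection

section Gates

variable {Ω : Finset ℝ} {G : Type u} [NormedAddCommGroup G] [InnerProductSpace ℂ G]

/-- The map underlying `rotate`. -/
noncomputable def rotateFun (α : Ω → ℝ) (Ψ : StateSpace Ω G Bool) : StateSpace Ω G Bool :=
  WithLp.toLp 2 (fun w => WithLp.toLp 2 (fun x =>
    if w then ((Real.sin (α x) : ℝ) : ℂ) • Ψ false x - ((Real.cos (α x) : ℝ) : ℂ) • Ψ true x
    else ((Real.cos (α x) : ℝ) : ℂ) • Ψ false x + ((Real.sin (α x) : ℝ) : ℂ) • Ψ true x))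

theorem norm_sq_add_norm_sq_rotate (c s : ℝ) (h : s ^ 2 + c ^ 2 = 1) (a b : G) :
    ‖(s : ℂ) • a - (c : ℂ) • b‖ ^ 2 + ‖(c : ℂ) • a + (s : ℂ) • b‖ ^ 2 = ‖b‖ ^ 2 + ‖a‖ ^ 2 := by
  rw [@norm_sub_sq ℂ, @norm_add_sq ℂ]
  simp only [norm_smul, inner_smul_left, inner_smul_right, Complex.conj_ofReal, mul_pow,
    Complex.norm_real, Real.norm_eq_abs, sq_abs, RCLike.re_to_complex, Complex.re_ofReal_mul]
  linear_combination (‖a‖ ^ 2 + ‖b‖ ^ 2) * h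

theorem norm_rotateFun (α : Ω → ℝ) (Ψ : StateSpace Ω G Bool) : ‖rotateFun α Ψ‖ = ‖Ψ‖ := by
  rw [← sq_eq_sq₀ (norm_nonneg _) (norm_nonneg _), PiLp.norm_sq_eq_of_L2, PiLp.norm_sq_eq_of_L2,
    Fintype.sum_bool, Fintype.sum_bool, PiLp.norm_sq_eq_of_L2, PiLp.norm_sq_eq_of_L2,
    PiLp.norm_sq_eq_of_L2, PiLp.norm_sq_eq_of_L2, ← Finset.sum_add_distrib,
    ← Finset.sum_add_distrib]
  refine Finset.sum_congr rfl fun x _ => ?_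
  exact norm_sq_add_norm_sq_rotate _ _ (Real.sin_sq_add_cos_sq (α x)) _ _

theorem rotateFun_rotateFun (α : Ω → ℝ) (Ψ : StateSpace Ω G Bool) :
    rotateFun α (rotateFun α Ψ) = Ψ := by
  have h : ∀ x, ((Real.sin (α x) : ℝ) : ℂ) * ((Real.sin (α x) : ℝ) : ℂ) +
      ((Real.cos (α x) : ℝ) : ℂ) * ((Real.cos (α x) : ℝ) : ℂ) = 1 := fun x => by
    have := Real.sin_sq_add_cos_sq (α x)
    rw [← Complex.ofReal_mul, ← Complex.ofReal_mul, ← Complex.ofReal_add, ← sq, ← sq, this]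
    simp
  ext w x
  cases w
  · simp only [rotateFun, if_true, if_false, Bool.false_eq_true]
    refine Eq.trans ?_ ((congrArg (· • Ψ false x) (h x)).trans (one_smul ℂ _))
    module
  · simp only [rotateFun, if_true, if_false, Bool.false_eq_true]
    refine Eq.trans ?_ ((congrArg (· • Ψ true x) (h x)).trans (one_smul ℂ _))
    module

/-- The controlled gate `|0⟩|x⟩ ↦ (cos (α x) |0⟩ + sin (α x) |1⟩)|x⟩`,
`|1⟩|x⟩ ↦ (sin (α x) |0⟩ - cos (α x) |1⟩)|x⟩` on the ancilla and the sample register. The sign makes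
it an involution. -/
noncomputable def rotate (α : Ω → ℝ) : StateSpace Ω G Bool ≃ₗᵢ[ℂ] StateSpace Ω G Bool where
  toFun := rotateFun α
  invFun := rotateFun α
  left_inv := rotateFun_rotateFun α
  right_inv := rotateFun_rotateFun α
  map_add' Ψ Φ := by
    ext w x
    cases w <;> simp [rotateFun] <;> abel
  map_smul' c Ψ := by
    ext w x
    cases w <;> simp [rotateFun, smul_sub, smul_comm c]
  norm_map' := norm_rotateFun α

/-- The sign change of the good states, those with ancilla `1`. -/
noncomputable def signFlip : StateSpace Ω G Bool ≃ₗᵢ[ℂ] StateSpace Ω G Bool :=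
  LinearIsometryEquiv.piLpCongrRight 2 fun w =>
    if w then LinearIsometryEquiv.neg ℂ else LinearIsometryEquiv.refl ℂ _

/-- The initial state `|0⟩ ⊗ |0⟩|0⟩` of ancilla, garbage and sample register. -/
noncomputable def startState (g₀ : G) (o₀ : EuclideanSpace ℂ Ω) : StateSpace Ω G Bool :=
  WithLp.toLp 2 (fun w => if w = false then productState g₀ o₀ else 0)

theorem norm_startState {g₀ : G} {o₀ : EuclideanSpace ℂ Ω} (hg : ‖g₀‖ = 1) (ho : ‖o₀‖ = 1) :
    ‖startState g₀ o₀‖ = 1 := by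
  have h1 : ‖productState g₀ o₀‖ = 1 := by
    rw [← sq_eq_sq₀ (norm_nonneg _) zero_le_one, PiLp.norm_sq_eq_of_L2]
    rw [← sq_eq_sq₀ (norm_nonneg _) zero_le_one, PiLp.norm_sq_eq_of_L2] at ho
    simpa [productState, norm_smul, hg] using ho
  rw [← sq_eq_sq₀ (norm_nonneg _) zero_le_one, PiLp.norm_sq_eq_of_L2]
  simp [startState, h1]

/-- Names of the elementary operations from which the circuits are built. They live in `Type`, as
the contents of the classical memory must, while the gates themselves live in `Type u`. -/
inductive Op (Ω : Finset ℝ) : Type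
  | query (inverse : Bool)
  | rotate (α : Ω → ℝ)
  | signFlip
  | reflect

/-- The unitary named by an elementary operation. -/
noncomputable def Op.act (g₀ : G) (o₀ : EuclideanSpace ℂ Ω)
    (S : SampleSpace Ω G ≃ₗᵢ[ℂ] SampleSpace Ω G) :
    Op Ω → StateSpace Ω G Bool → StateSpace Ω G Bool
  | .query inverse => applyQuery S inverse (fun _ => true)
  | .rotate α => QuantumSampling.rotate α
  | .signFlip => QuantumSampling.signFlip
  | .reflect => reflectAcross (startState g₀ o₀)

/-- One Grover iteration. -/
def groverOps (α : Ω → ℝ) : List (Op Ω) :=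
  [.signFlip, .rotate α, .query true, .reflect, .query false, .rotate α]

/-- Preparation of the state with rotation angles `α`, followed by `m` Grover iterations. -/
def circuit (α : Ω → ℝ) (m : ℕ) : List (Op Ω) :=
  [.query false, .rotate α] ++ (List.replicate m (groverOps α)).flatten

/-- The state after the operations `ops`, executed from left to right. -/
noncomputable def execute (g₀ : G) (o₀ : EuclideanSpace ℂ Ω)
    (S : SampleSpace Ω G ≃ₗᵢ[ℂ] SampleSpace Ω G) (ops : List (Op Ω))
    (Ψ : StateSpace Ω G Bool) : StateSpace Ω G Bool :=
  ops.foldl (fun Φ op => op.act g₀ o₀ S Φ) Ψ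

/-- The value of the ancilla as an outcome of a measurement. -/
def bitIndex (w : Bool) : Fin 2 := if w then 1 else 0

/-- The probability that the ancilla of the prepared state reads `1`. -/
noncomputable def hitProb (d α : Ω → ℝ) : ℝ := ∑ x, d x * Real.sin (α x) ^ 2

/-- The angle `θ ∈ [0, π / 2]` with `sin² θ = hitProb d α`. -/
noncomputable def groverAngle (d α : Ω → ℝ) : ℝ := Real.arcsin (Real.sqrt (hitProb d α))

variable {d α : Ω → ℝ}

theorem hitProb_nonneg (hd : d ∈ stdSimplex ℝ Ω) : 0 ≤ hitProb d α :=
  Finset.sum_nonneg fun x _ => mul_nonneg (hd.1 x) (sq_nonneg _)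

theorem hitProb_le_one (hd : d ∈ stdSimplex ℝ Ω) : hitProb d α ≤ 1 := by
  rw [← hd.2]
  refine Finset.sum_le_sum fun x _ => mul_le_of_le_one_right (hd.1 x) (Real.sin_sq_le_one _)

theorem sin_groverAngle_sq (hd : d ∈ stdSimplex ℝ Ω) :
    Real.sin (groverAngle d α) ^ 2 = hitProb d α := by
  have h0 := hitProb_nonneg (α := α) hd
  have h1 := hitProb_le_one (α := α) hd
  rw [groverAngle, Real.sin_arcsin (by linarith [Real.sqrt_nonneg (hitProb d α)])
    (Real.sqrt_le_one.2 h1), Real.sq_sqrt h0]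

theorem cos_groverAngle_sq (hd : d ∈ stdSimplex ℝ Ω) :
    Real.cos (groverAngle d α) ^ 2 = ∑ x, d x * Real.cos (α x) ^ 2 := by
  rw [Real.cos_sq', sin_groverAngle_sq hd, ← hd.2, hitProb, ← Finset.sum_sub_distrib]
  refine Finset.sum_congr rfl fun x _ => ?_
  rw [Real.cos_sq']; ring

theorem groverAngle_nonneg : 0 ≤ groverAngle d α := Real.arcsin_nonneg.2 (Real.sqrt_nonneg _)

theorem groverAngle_le : groverAngle d α ≤ Real.pi / 2 := Real.arcsin_le_pi_div_two _

variable {g₀ : G} {o₀ : EuclideanSpace ℂ Ω} {S : SampleSpace Ω G ≃ₗᵢ[ℂ] SampleSpace Ω G}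

/-- The sampler acting on all registers. -/
noncomputable def liftSampler (S : SampleSpace Ω G ≃ₗᵢ[ℂ] SampleSpace Ω G) :
    StateSpace Ω G Bool ≃ₗᵢ[ℂ] StateSpace Ω G Bool :=
  LinearIsometryEquiv.piLpCongrRight 2 fun _ => S

theorem applyQuery_false (Ψ : StateSpace Ω G Bool) :
    applyQuery S false (fun _ => true) Ψ = liftSampler S Ψ := by
  ext w x
  simp [applyQuery, liftSampler]

theorem applyQuery_true (Ψ : StateSpace Ω G Bool) :
    applyQuery S true (fun _ => true) Ψ = (liftSampler S).symm Ψ := by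
  ext w x
  simp [applyQuery, liftSampler]

/-- The state prepared before the first Grover iteration. -/
noncomputable def prepared (g₀ : G) (o₀ : EuclideanSpace ℂ Ω)
    (S : SampleSpace Ω G ≃ₗᵢ[ℂ] SampleSpace Ω G) (α : Ω → ℝ) : StateSpace Ω G Bool :=
  rotate α (liftSampler S (startState g₀ o₀))

/-- A Grover iteration is the sign change of the good states followed by the reflection about the
prepared state. -/
theorem execute_groverOps (hg : ‖g₀‖ = 1) (ho : ‖o₀‖ = 1) (Ψ : StateSpace Ω G Bool) :
    execute g₀ o₀ S (groverOps α) Ψ =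
      (2 * inner ℂ (prepared g₀ o₀ S α) (signFlip Ψ)) • prepared g₀ o₀ S α - signFlip Ψ := by
  have hn : ‖startState g₀ o₀‖ = 1 := norm_startState hg ho
  simp only [execute, groverOps, List.foldl_cons, List.foldl_nil, Op.act, applyQuery_false,
    applyQuery_true]
  rw [reflectAcross_apply hn]
  have hinv : ∀ Φ : StateSpace Ω G Bool, rotate α (rotate α Φ) = Φ := rotateFun_rotateFun α
  have hin : inner ℂ (startState g₀ o₀) ((liftSampler S).symm (rotate α (signFlip Ψ))) =
      inner ℂ (prepared g₀ o₀ S α) (signFlip Ψ) := by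
    rw [← (liftSampler S).inner_map_map, LinearIsometryEquiv.apply_symm_apply,
      ← (rotate α).inner_map_map, hinv]
    rfl
  rw [hin]
  simp only [map_sub, map_smul, LinearIsometryEquiv.apply_symm_apply, hinv]
  rfl

theorem collapse_one_add_collapse_zero (Ψ : StateSpace Ω G Bool) :
    collapse bitIndex 1 Ψ + collapse bitIndex 0 Ψ = Ψ := by
  ext w x
  cases w <;> simp [collapse, bitIndex]

theorem norm_collapse_one_sq (Ψ : StateSpace Ω G Bool) :
    ‖collapse bitIndex 1 Ψ‖ ^ 2 = ‖Ψ true‖ ^ 2 := by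
  rw [PiLp.norm_sq_eq_of_L2]; simp [collapse, bitIndex]

theorem norm_collapse_zero_sq (Ψ : StateSpace Ω G Bool) :
    ‖collapse bitIndex 0 Ψ‖ ^ 2 = ‖Ψ false‖ ^ 2 := by
  rw [PiLp.norm_sq_eq_of_L2]; simp [collapse, bitIndex]

theorem inner_collapse (Ψ Φ : StateSpace Ω G Bool) :
    inner ℂ (collapse bitIndex 1 Ψ) (collapse bitIndex 0 Φ) = 0 := by
  simp [PiLp.inner_apply, collapse, bitIndex]

theorem norm_prepared (hd : d ∈ stdSimplex ℝ Ω) (hS : IsSampler g₀ o₀ d S) :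
    ‖prepared g₀ o₀ S α true‖ ^ 2 = Real.sin (groverAngle d α) ^ 2 ∧
    ‖prepared g₀ o₀ S α false‖ ^ 2 = Real.cos (groverAngle d α) ^ 2 := by
  obtain ⟨ψ, hψ, h⟩ := hS
  have h0 : liftSampler S (startState g₀ o₀) = WithLp.toLp 2 (fun w => if w = false then
      WithLp.toLp 2 (fun x => ((Real.sqrt (d x) : ℝ) : ℂ) • ψ x) else 0) := by
    ext w x
    cases w <;> simp [liftSampler, startState, h]
  rw [sin_groverAngle_sq hd, cos_groverAngle_sq hd, hitProb, PiLp.norm_sq_eq_of_L2,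
    PiLp.norm_sq_eq_of_L2, prepared, h0]
  constructor
  all_goals
    refine Finset.sum_congr rfl fun x _ => ?_
    simp only [rotate, LinearIsometryEquiv.coe_mk, LinearEquiv.coe_mk, rotateFun,
      LinearMap.coe_mk, AddHom.coe_mk]
    simp [norm_smul, hψ, mul_pow, Real.sq_sqrt (hd.1 x), mul_comm, -Complex.ofReal_sin,
      -Complex.ofReal_cos]

theorem execute_circuit (m : ℕ) :
    execute g₀ o₀ S (circuit α m) (startState g₀ o₀) =
      (execute g₀ o₀ S (groverOps α))^[m] (prepared g₀ o₀ S α) := by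
  have key : ∀ (m : ℕ) (Ψ : StateSpace Ω G Bool),
      execute g₀ o₀ S (List.replicate m (groverOps α)).flatten Ψ =
        (execute g₀ o₀ S (groverOps α))^[m] Ψ := by
    intro m
    induction m with
    | zero => intro Ψ; rfl
    | succ m ih =>
      intro Ψ
      rw [List.replicate_succ, List.flatten_cons, Function.iterate_succ_apply, ← ih, execute,
        List.foldl_append]
      rfl
  rw [← key, execute, circuit, List.foldl_append]
  simp only [List.foldl_cons, List.foldl_nil, Op.act, applyQuery_false]
  rfl

/-- The outcome probabilities after `m` Grover iterations. -/
theorem norm_collapse_execute_circuit (hg : ‖g₀‖ = 1) (ho : ‖o₀‖ = 1)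
    (hd : d ∈ stdSimplex ℝ Ω) (hS : IsSampler g₀ o₀ d S) (m : ℕ) :
    ‖collapse bitIndex 1 (execute g₀ o₀ S (circuit α m) (startState g₀ o₀))‖ ^ 2 =
        Real.sin ((2 * m + 1) * groverAngle d α) ^ 2 ∧
    ‖collapse bitIndex 0 (execute g₀ o₀ S (circuit α m) (startState g₀ o₀))‖ ^ 2 =
        1 - Real.sin ((2 * m + 1) * groverAngle d α) ^ 2 := by
  set ψ := prepared g₀ o₀ S α with hψ
  obtain ⟨h1, h0⟩ := norm_prepared (α := α) hd hS
  set θ := groverAngle d α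
  rw [← norm_collapse_one_sq, ← hψ] at h1
  rw [← norm_collapse_zero_sq, ← hψ] at h0
  set ψ₁ := collapse bitIndex 1 ψ with hψ₁
  set ψ₀ := collapse bitIndex 0 ψ with hψ₀
  have hsum : ψ₁ + ψ₀ = ψ := collapse_one_add_collapse_zero ψ
  have horth : inner ℂ ψ₁ ψ₀ = 0 := inner_collapse _ _
  have horth' : inner ℂ ψ₀ ψ₁ = 0 := inner_eq_zero_symm.1 horth
  have hflip : ∀ x y : ℝ, signFlip ((x : ℂ) • ψ₁ + (y : ℂ) • ψ₀) =
      (-x : ℂ) • ψ₁ + (y : ℂ) • ψ₀ := by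
    intro x y
    ext w z
    cases w <;> simp [signFlip, hψ₁, hψ₀, collapse, bitIndex]
  obtain ⟨x, y, hxy, hx, hy⟩ := exists_iterate_eq_of_rotation (ψ₁ := ψ₁) (ψ₀ := ψ₀) (θ := θ)
    (D := execute g₀ o₀ S (groverOps α)) (fun x y => by
      rw [execute_groverOps hg ho, hflip, ← hψ, ← hsum, inner_add_left, inner_add_right,
        inner_add_right, inner_smul_right, inner_smul_right, inner_smul_right, inner_smul_right,
        horth, horth', inner_self_eq_norm_sq_to_K, inner_self_eq_norm_sq_to_K]
      have h1' : ((‖ψ₁‖ : ℂ)) ^ 2 = (Real.sin θ : ℂ) ^ 2 := by exact_mod_cast h1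
      have h0' : ((‖ψ₀‖ : ℂ)) ^ 2 = (Real.cos θ : ℂ) ^ 2 := by exact_mod_cast h0
      simp only [Complex.coe_algebraMap]
      rw [h1', h0']
      push_cast
      module) m
  rw [execute_circuit, ← hψ, ← hsum, hxy]
  have c1 : collapse bitIndex 1 ((x : ℂ) • ψ₁ + (y : ℂ) • ψ₀) = (x : ℂ) • ψ₁ := by
    ext w z
    cases w <;> simp [hψ₁, hψ₀, collapse, bitIndex]
  have c0 : collapse bitIndex 0 ((x : ℂ) • ψ₁ + (y : ℂ) • ψ₀) = (y : ℂ) • ψ₀ := by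
    ext w z
    cases w <;> simp [hψ₁, hψ₀, collapse, bitIndex]
  rw [c1, c0, norm_smul, norm_smul, mul_pow, mul_pow, h1, h0, ← Real.cos_sq', ← hx, ← hy]
  simp [mul_pow]

end Gates

/-! ### Homogeneity, monotonicity and limits of the weights of an algorithm -/

section Semantics

variable {Ω : Finset ℝ} {G : Type u} [NormedAddCommGroup G] [InnerProductSpace ℂ G]
  {g₀ : G} {o₀ : EuclideanSpace ℂ Ω} {S : SampleSpace Ω G ≃ₗᵢ[ℂ] SampleSpace Ω G}

theorem applyQuery_smul {W : Type} [Fintype W] (b : Bool) (ctrl : W → Bool) (r : ℂ)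
    (Ψ : StateSpace Ω G W) : applyQuery S b ctrl (r • Ψ) = r • applyQuery S b ctrl Ψ := by
  ext w x
  simp only [applyQuery, PiLp.smul_apply, map_smul]
  split_ifs <;> simp

theorem collapse_smul {W : Type} [Fintype W] {k : ℕ} (f : W → Fin k) (i : Fin k) (r : ℂ)
    (Ψ : StateSpace Ω G W) : collapse f i (r • Ψ) = r • collapse f i Ψ := by
  ext w x
  simp only [collapse, PiLp.smul_apply]
  split_ifs <;> simp

theorem norm_applyQuery {W : Type} [Fintype W] (b : Bool) (ctrl : W → Bool)
    (Ψ : StateSpace Ω G W) : ‖applyQuery S b ctrl Ψ‖ = ‖Ψ‖ := by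
  rw [← sq_eq_sq₀ (norm_nonneg _) (norm_nonneg _), PiLp.norm_sq_eq_of_L2, PiLp.norm_sq_eq_of_L2]
  refine Finset.sum_congr rfl fun w _ => ?_
  simp only [applyQuery]
  split_ifs <;> simp

theorem sum_norm_collapse_sq {W : Type} [Fintype W] {k : ℕ} (f : W → Fin k)
    (Ψ : StateSpace Ω G W) : ∑ i, ‖collapse f i Ψ‖ ^ 2 = ‖Ψ‖ ^ 2 := by
  simp only [PiLp.norm_sq_eq_of_L2, collapse]
  rw [Finset.sum_comm]
  refine Finset.sum_congr rfl fun w _ => ?_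
  rw [Finset.sum_eq_single (f w)]
  · simp
  · intro i _ hi
    simp [hi.symm]
  · simp

variable (A : Algorithm Ω G)

theorem norm_ofReal_smul_sq {V : Type*} [NormedAddCommGroup V] [NormedSpace ℂ V] {r : ℝ} (v : V) :
    ENNReal.ofReal (‖(r : ℂ) • v‖ ^ 2) = ENNReal.ofReal (r ^ 2) * ENNReal.ofReal (‖v‖ ^ 2) := by
  rw [norm_smul, mul_pow, ENNReal.ofReal_mul (by positivity)]
  simp

theorem ofReal_norm_smul {V : Type*} [NormedAddCommGroup V] [NormedSpace ℂ V] {r : ℝ}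
    (hr : 0 ≤ r) (v : V) : ((‖(r : ℂ) • v‖ : ℝ) : ℂ) = (r : ℂ) * (‖v‖ : ℂ) := by
  rw [norm_smul, Complex.norm_real, Real.norm_of_nonneg hr]
  push_cast; rfl

theorem outputWeight_smul (T : Set ℝ) (n : ℕ) (m : A.Mem) {r : ℝ} (hr : 0 ≤ r)
    (Ψ : StateSpace Ω G A.Work) :
    A.outputWeight g₀ o₀ S T n m ((r : ℂ) • Ψ) =
      ENNReal.ofReal (r ^ 2) * A.outputWeight g₀ o₀ S T n m Ψ := by
  induction n generalizing m Ψ with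
  | zero => simp [Algorithm.outputWeight]
  | succ n ih =>
    simp only [Algorithm.outputWeight]
    cases A.instr m with
    | halt s =>
      by_cases hs : s ∈ T
      · simp only [Set.indicator_of_mem hs, norm_ofReal_smul_sq]
      · simp [hs]
    | gate U next => simp only [map_smul, ih]
    | query b ctrl next => simp only [applyQuery_smul, ih]
    | measure k f next => simp only [collapse_smul, ih, Finset.mul_sum]
    | reset next =>
      simp only
      rw [ofReal_norm_smul hr, mul_smul, ih]

theorem queryWeight_smul (n : ℕ) (m : A.Mem) {r : ℝ} (hr : 0 ≤ r)
    (Ψ : StateSpace Ω G A.Work) :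
    A.queryWeight g₀ o₀ S n m ((r : ℂ) • Ψ) =
      ENNReal.ofReal (r ^ 2) * A.queryWeight g₀ o₀ S n m Ψ := by
  induction n generalizing m Ψ with
  | zero => simp [Algorithm.queryWeight]
  | succ n ih =>
    simp only [Algorithm.queryWeight]
    cases A.instr m with
    | halt s => simp
    | gate U next => simp only [map_smul, ih]
    | query b ctrl next => simp only [applyQuery_smul, ih, norm_ofReal_smul_sq, mul_add]
    | measure k f next => simp only [collapse_smul, ih, Finset.mul_sum]
    | reset next =>
      simp only
      rw [ofReal_norm_smul hr, mul_smul, ih]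

theorem outputWeight_le_succ (T : Set ℝ) (n : ℕ) (m : A.Mem) (Ψ : StateSpace Ω G A.Work) :
    A.outputWeight g₀ o₀ S T n m Ψ ≤ A.outputWeight g₀ o₀ S T (n + 1) m Ψ := by
  induction n generalizing m Ψ with
  | zero => simp [Algorithm.outputWeight]
  | succ n ih =>
    rw [Algorithm.outputWeight, Algorithm.outputWeight]
    cases A.instr m with
    | halt s => exact le_rfl
    | gate U next => exact ih _ _
    | query b ctrl next => exact ih _ _
    | measure k f next => exact Finset.sum_le_sum fun i _ => ih _ _
    | reset next => exact ih _ _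

theorem outputWeight_mono (T : Set ℝ) (m : A.Mem) (Ψ : StateSpace Ω G A.Work) :
    Monotone fun n => A.outputWeight g₀ o₀ S T n m Ψ :=
  monotone_nat_of_le_succ fun n => outputWeight_le_succ A T n m Ψ

theorem queryWeight_le_succ (n : ℕ) (m : A.Mem) (Ψ : StateSpace Ω G A.Work) :
    A.queryWeight g₀ o₀ S n m Ψ ≤ A.queryWeight g₀ o₀ S (n + 1) m Ψ := by
  induction n generalizing m Ψ with
  | zero => simp [Algorithm.queryWeight]
  | succ n ih =>
    rw [Algorithm.queryWeight, Algorithm.queryWeight]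
    cases A.instr m with
    | halt s => exact le_rfl
    | gate U next => exact ih _ _
    | query b ctrl next => exact add_le_add le_rfl (ih _ _)
    | measure k f next => exact Finset.sum_le_sum fun i _ => ih _ _
    | reset next => exact ih _ _

theorem outputWeight_le_norm_sq (h1 : ‖A.initState g₀ o₀‖ = 1) (T : Set ℝ) (n : ℕ) (m : A.Mem)
    (Ψ : StateSpace Ω G A.Work) :
    A.outputWeight g₀ o₀ S T n m Ψ ≤ ENNReal.ofReal (‖Ψ‖ ^ 2) := by
  induction n generalizing m Ψ with
  | zero => simp [Algorithm.outputWeight]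
  | succ n ih =>
    rw [Algorithm.outputWeight]
    cases A.instr m with
    | halt s => exact Set.indicator_apply_le' (fun _ => le_rfl) (fun _ => zero_le)
    | gate U next => exact (ih _ _).trans (by rw [LinearIsometryEquiv.norm_map])
    | query b ctrl next => exact (ih _ _).trans (by rw [norm_applyQuery])
    | measure k f next =>
      refine (Finset.sum_le_sum fun i _ => ih _ _).trans ?_
      rw [← ENNReal.ofReal_sum_of_nonneg (fun i _ => by positivity), sum_norm_collapse_sq]
    | reset next => exact (ih _ _).trans (by simp [norm_smul, h1])

/-- The probability weight with which the algorithm, started with memory content `m` in the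
unnormalised state `Ψ`, ever halts with an output in `T`. -/
noncomputable def Algorithm.haltWeight (A : Algorithm Ω G) (g₀ : G) (o₀ : EuclideanSpace ℂ Ω)
    (S : SampleSpace Ω G ≃ₗᵢ[ℂ] SampleSpace Ω G) (T : Set ℝ) (m : A.Mem)
    (Ψ : StateSpace Ω G A.Work) : ℝ≥0∞ :=
  ⨆ n, A.outputWeight g₀ o₀ S T n m Ψ

theorem haltWeight_eq_succ (T : Set ℝ) (m : A.Mem) (Ψ : StateSpace Ω G A.Work) :
    A.haltWeight g₀ o₀ S T m Ψ = ⨆ n, A.outputWeight g₀ o₀ S T (n + 1) m Ψ :=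
  ((outputWeight_mono A T m Ψ).iSup_nat_add 1).symm

theorem haltWeight_halt {T : Set ℝ} {m : A.Mem} {s : ℝ} (h : A.instr m = .halt s)
    (Ψ : StateSpace Ω G A.Work) :
    A.haltWeight g₀ o₀ S T m Ψ = T.indicator (fun _ => ENNReal.ofReal (‖Ψ‖ ^ 2)) s := by
  rw [haltWeight_eq_succ]
  simp only [Algorithm.outputWeight, h, ciSup_const]

theorem haltWeight_gate {T : Set ℝ} {m next : A.Mem}
    {U : StateSpace Ω G A.Work ≃ₗᵢ[ℂ] StateSpace Ω G A.Work} (h : A.instr m = .gate U next)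
    (Ψ : StateSpace Ω G A.Work) :
    A.haltWeight g₀ o₀ S T m Ψ = A.haltWeight g₀ o₀ S T next (U Ψ) := by
  rw [haltWeight_eq_succ]
  simp only [Algorithm.outputWeight, h, Algorithm.haltWeight]

theorem haltWeight_query {T : Set ℝ} {m next : A.Mem} {b : Bool} {ctrl : A.Work → Bool}
    (h : A.instr m = .query b ctrl next) (Ψ : StateSpace Ω G A.Work) :
    A.haltWeight g₀ o₀ S T m Ψ = A.haltWeight g₀ o₀ S T next (applyQuery S b ctrl Ψ) := by
  rw [haltWeight_eq_succ]
  simp only [Algorithm.outputWeight, h, Algorithm.haltWeight]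

theorem haltWeight_measure {T : Set ℝ} {m : A.Mem} {k : ℕ} {f : A.Work → Fin k}
    {next : Fin k → A.Mem} (h : A.instr m = .measure k f next) (Ψ : StateSpace Ω G A.Work) :
    A.haltWeight g₀ o₀ S T m Ψ = ∑ i, A.haltWeight g₀ o₀ S T (next i) (collapse f i Ψ) := by
  rw [haltWeight_eq_succ]
  simp only [Algorithm.outputWeight, h, Algorithm.haltWeight]
  rw [ENNReal.finsetSum_iSup_of_monotone]
  exact fun i => outputWeight_mono A T _ _

theorem haltWeight_reset {T : Set ℝ} {m next : A.Mem} (h : A.instr m = .reset next)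
    (Ψ : StateSpace Ω G A.Work) :
    A.haltWeight g₀ o₀ S T m Ψ =
      A.haltWeight g₀ o₀ S T next ((‖Ψ‖ : ℂ) • A.initState g₀ o₀) := by
  rw [haltWeight_eq_succ]
  simp only [Algorithm.outputWeight, h, Algorithm.haltWeight]

theorem haltWeight_smul (T : Set ℝ) (m : A.Mem) {r : ℝ} (hr : 0 ≤ r)
    (Ψ : StateSpace Ω G A.Work) :
    A.haltWeight g₀ o₀ S T m ((r : ℂ) • Ψ) =
      ENNReal.ofReal (r ^ 2) * A.haltWeight g₀ o₀ S T m Ψ := by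
  simp only [Algorithm.haltWeight, outputWeight_smul A T _ _ hr, ENNReal.mul_iSup]

end Semantics

/-! ### Sequences of protocols as quantum algorithms -/

section Compile

variable {Ω : Finset ℝ} {G : Type u} [NormedAddCommGroup G] [InnerProductSpace ℂ G]

/-- An experiment: the family of rotation angles and the number of Grover iterations. -/
abbrev Experiment (Ω : Finset ℝ) : Type := (Ω → ℝ) × ℕ

/-- A protocol whose result is a final output, or the index of the next round. -/
abbrev Round (Ω : Finset ℝ) : Type := Protocol (Experiment Ω) (ℝ ⊕ ℕ)

/-- The classical memory: stopped with an output, about to reset the registers and go on with the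
protocol `t`, or in the middle of a circuit, after which the ancilla is measured and the protocol
`k b` follows upon the outcome `b`. -/
inductive Memory (Ω : Finset ℝ) : Type
  | halted (r : ℝ)
  | fresh (t : Round Ω)
  | running (ops : List (Op Ω)) (k : Bool → Round Ω)

/-- The memory content after a round with the given result, where `prog i` is the `i`-th round. -/
def Memory.ofResult (prog : ℕ → Round Ω) : ℝ ⊕ ℕ → Memory Ω
  | .inl r => .halted r
  | .inr i => .fresh (prog i)

/-- The memory content after the reset that precedes the protocol. -/
def Memory.start (prog : ℕ → Round Ω) : Round Ω → Memory Ω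
  | .ret a => Memory.ofResult prog a
  | .run e k => .running (circuit e.1 e.2) k

/-- The instruction that executes an elementary operation. -/
noncomputable def Op.toInstr (g₀ : G) (o₀ : EuclideanSpace ℂ Ω) (next : Memory Ω) :
    Op Ω → Instr Ω G Bool (Memory Ω)
  | .query inverse => .query inverse (fun _ => true) next
  | .rotate α => .gate (QuantumSampling.rotate α) next
  | .signFlip => .gate QuantumSampling.signFlip next
  | .reflect => .gate (reflectAcross (startState g₀ o₀)) next

/-- The quantum algorithm that runs the rounds of `prog`, starting with round `0`. Its workspace is
the ancilla. -/
noncomputable def compile (g₀ : G) (o₀ : EuclideanSpace ℂ Ω) (prog : ℕ → Round Ω) :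
    Algorithm Ω G where
  Work := Bool
  Mem := Memory Ω
  work₀ := false
  mem₀ := .fresh (prog 0)
  instr
    | .halted r => .halt r
    | .fresh t => .reset (Memory.start prog t)
    | .running [] k => .measure 2 bitIndex (fun i => .fresh (k (i = 1)))
    | .running (op :: ops) k => op.toInstr g₀ o₀ (.running ops k)

variable {g₀ : G} {o₀ : EuclideanSpace ℂ Ω} {S : SampleSpace Ω G ≃ₗᵢ[ℂ] SampleSpace Ω G}
  {d : Ω → ℝ} (prog : ℕ → Round Ω)

/-- The weight with which the compiled program, started in the given situation, outputs an element
of `T`. It is `Algorithm.haltWeight` with the types of memory and workspace spelled out. -/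
noncomputable def runWeight (g₀ : G) (o₀ : EuclideanSpace ℂ Ω)
    (S : SampleSpace Ω G ≃ₗᵢ[ℂ] SampleSpace Ω G) (prog : ℕ → Round Ω) (T : Set ℝ)
    (m : Memory Ω) (Ψ : StateSpace Ω G Bool) : ℝ≥0∞ :=
  (compile g₀ o₀ prog).haltWeight g₀ o₀ S T m Ψ

/-- The expected number of samples used within `n` instructions by the compiled program; it is
`Algorithm.queryWeight` with the types of memory and workspace spelled out. -/
noncomputable def runSamples (g₀ : G) (o₀ : EuclideanSpace ℂ Ω)
    (S : SampleSpace Ω G ≃ₗᵢ[ℂ] SampleSpace Ω G) (prog : ℕ → Round Ω) (n : ℕ)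
    (m : Memory Ω) (Ψ : StateSpace Ω G Bool) : ℝ≥0∞ :=
  (compile g₀ o₀ prog).queryWeight g₀ o₀ S n m Ψ

/-- The number of quantum samples used by an elementary operation. -/
def Op.cost : Op Ω → ℕ
  | .query _ => 1
  | .rotate _ => 0
  | .signFlip => 0
  | .reflect => 0

/-- The success probability of an experiment, for a sampler of `d`. -/
noncomputable def successProb (d : Ω → ℝ) (e : Experiment Ω) : ℝ :=
  Real.sin ((2 * e.2 + 1) * groverAngle d e.1) ^ 2

theorem successProb_mem (d : Ω → ℝ) (e : Experiment Ω) :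
    0 ≤ successProb d e ∧ successProb d e ≤ 1 :=
  ⟨sq_nonneg _, Real.sin_sq_le_one _⟩

/-- The number of quantum samples used by an experiment. -/
noncomputable def experimentCost (e : Experiment Ω) : ℝ≥0∞ := ((2 * e.2 + 1 : ℕ) : ℝ≥0∞)

theorem runWeight_halted {T : Set ℝ} (r : ℝ) (Ψ : StateSpace Ω G Bool) :
    runWeight g₀ o₀ S prog T (.halted r) Ψ =
      T.indicator (fun _ => ENNReal.ofReal (‖Ψ‖ ^ 2)) r :=
  haltWeight_halt (compile g₀ o₀ prog) rfl Ψ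

theorem runWeight_fresh_eq_start {T : Set ℝ} (t : Round Ω) (Ψ : StateSpace Ω G Bool) :
    runWeight g₀ o₀ S prog T (.fresh t) Ψ = ENNReal.ofReal (‖Ψ‖ ^ 2) *
      runWeight g₀ o₀ S prog T (Memory.start prog t) (startState g₀ o₀) :=
  (haltWeight_reset (compile g₀ o₀ prog) rfl Ψ).trans
    (haltWeight_smul (compile g₀ o₀ prog) T _ (norm_nonneg _) _)

theorem runWeight_running_nil {T : Set ℝ} (k : Bool → Round Ω) (Ψ : StateSpace Ω G Bool) :
    runWeight g₀ o₀ S prog T (.running [] k) Ψ =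
      runWeight g₀ o₀ S prog T (.fresh (k false)) (collapse bitIndex 0 Ψ) +
      runWeight g₀ o₀ S prog T (.fresh (k true)) (collapse bitIndex 1 Ψ) :=
  (haltWeight_measure (compile g₀ o₀ prog) (k := 2) (f := bitIndex)
    (next := fun i => .fresh (k (i = 1))) rfl Ψ).trans (Fin.sum_univ_two _)

theorem runWeight_running (T : Set ℝ) (ops : List (Op Ω)) (k : Bool → Round Ω)
    (Ψ : StateSpace Ω G Bool) :
    runWeight g₀ o₀ S prog T (.running ops k) Ψ =
      runWeight g₀ o₀ S prog T (.running [] k) (execute g₀ o₀ S ops Ψ) := by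
  induction ops generalizing Ψ with
  | nil => rfl
  | cons op ops ih =>
    have h : runWeight g₀ o₀ S prog T (.running (op :: ops) k) Ψ =
        runWeight g₀ o₀ S prog T (.running ops k) (op.act g₀ o₀ S Ψ) := by
      cases op with
      | query b => exact haltWeight_query (compile g₀ o₀ prog) rfl Ψ
      | rotate α => exact haltWeight_gate (compile g₀ o₀ prog) rfl Ψ
      | signFlip => exact haltWeight_gate (compile g₀ o₀ prog) rfl Ψ
      | reflect => exact haltWeight_gate (compile g₀ o₀ prog) rfl Ψ
    rw [h, ih]
    rfl

/-- On freshly prepared registers a protocol behaves like its classical model. -/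
theorem runWeight_fresh (hg : ‖g₀‖ = 1) (ho : ‖o₀‖ = 1) (hd : d ∈ stdSimplex ℝ Ω)
    (hS : IsSampler g₀ o₀ d S) (T : Set ℝ) (t : Round Ω) :
    runWeight g₀ o₀ S prog T (.fresh t) (startState g₀ o₀) =
      t.expect 0 (successProb d) (fun a => runWeight g₀ o₀ S prog T
        (Memory.ofResult prog a) (startState g₀ o₀)) := by
  have hn := norm_startState hg ho
  have h : ∀ t Ψ, runWeight g₀ o₀ S prog T (.fresh t) Ψ = ENNReal.ofReal (‖Ψ‖ ^ 2) *
      runWeight g₀ o₀ S prog T (.fresh t) (startState g₀ o₀) := fun t Ψ => by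
    rw [runWeight_fresh_eq_start, runWeight_fresh_eq_start prog t (startState g₀ o₀), hn]
    simp
  induction t with
  | ret a =>
    rw [runWeight_fresh_eq_start, hn]
    simp [Memory.start, Protocol.expect]
  | run e k ih =>
    obtain ⟨h1, h0⟩ := norm_collapse_execute_circuit (α := e.1) hg ho hd hS e.2
    rw [runWeight_fresh_eq_start, hn, Memory.start, runWeight_running, runWeight_running_nil, h,
      h (k true), h1, h0, ih, ih]
    simp [Protocol.expect, successProb]

theorem runSamples_le_succ (n : ℕ) (m : Memory Ω) (Ψ : StateSpace Ω G Bool) :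
    runSamples g₀ o₀ S prog n m Ψ ≤ runSamples g₀ o₀ S prog (n + 1) m Ψ :=
  queryWeight_le_succ (compile g₀ o₀ prog) n m Ψ

theorem runSamples_running (ops : List (Op Ω)) (k : Bool → Round Ω) (n : ℕ)
    (Ψ : StateSpace Ω G Bool) :
    runSamples g₀ o₀ S prog n (.running ops k) Ψ ≤
      ENNReal.ofReal (‖Ψ‖ ^ 2) * (((ops.map Op.cost).sum : ℕ) : ℝ≥0∞) +
      runSamples g₀ o₀ S prog n (.running [] k) (execute g₀ o₀ S ops Ψ) := by
  induction ops generalizing n Ψ with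
  | nil => simp [execute]
  | cons op ops ih =>
    cases n with
    | zero => simp [runSamples, Algorithm.queryWeight]
    | succ n =>
      have hstep : runSamples g₀ o₀ S prog (n + 1) (.running (op :: ops) k) Ψ =
          ENNReal.ofReal (‖Ψ‖ ^ 2) * ((op.cost : ℕ) : ℝ≥0∞) +
          runSamples g₀ o₀ S prog n (.running ops k) (op.act g₀ o₀ S Ψ) := by
        cases op with
        | query b => rw [Op.cost, Nat.cast_one, mul_one]; rfl
        | rotate α => rw [Op.cost, Nat.cast_zero, mul_zero, zero_add]; rfl
        | signFlip => rw [Op.cost, Nat.cast_zero, mul_zero, zero_add]; rfl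
        | reflect => rw [Op.cost, Nat.cast_zero, mul_zero, zero_add]; rfl
      have hnorm : ‖op.act g₀ o₀ S Ψ‖ = ‖Ψ‖ := by
        cases op with
        | query b => exact norm_applyQuery _ _ _
        | rotate α => exact LinearIsometryEquiv.norm_map _ _
        | signFlip => exact LinearIsometryEquiv.norm_map _ _
        | reflect => exact LinearIsometryEquiv.norm_map _ _
      rw [hstep, List.map_cons, List.sum_cons, Nat.cast_add, mul_add, add_assoc]
      refine add_le_add le_rfl ((ih n _).trans ?_)
      rw [hnorm]
      exact add_le_add le_rfl (runSamples_le_succ prog n _ _)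

theorem sum_cost_circuit (α : Ω → ℝ) (m : ℕ) :
    ((circuit α m).map Op.cost).sum = 2 * m + 1 := by
  have : ∀ m, (((List.replicate m (groverOps α)).flatten).map Op.cost).sum = 2 * m := by
    intro m
    induction m with
    | zero => rfl
    | succ m ih =>
      rw [List.replicate_succ, List.flatten_cons, List.map_append, List.sum_append, ih]
      simp [groverOps, Op.cost]
      ring
  rw [circuit, List.map_append, List.sum_append, this]
  simp [Op.cost]
  ring

theorem runSamples_fresh_eq_start (t : Round Ω) (n : ℕ) (Ψ : StateSpace Ω G Bool) :
    runSamples g₀ o₀ S prog (n + 1) (.fresh t) Ψ = ENNReal.ofReal (‖Ψ‖ ^ 2) *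
      runSamples g₀ o₀ S prog n (Memory.start prog t) (startState g₀ o₀) :=
  queryWeight_smul (compile g₀ o₀ prog) n (Memory.start prog t) (norm_nonneg _) _

theorem runSamples_running_nil (n : ℕ) (k : Bool → Round Ω) (Ψ : StateSpace Ω G Bool) :
    runSamples g₀ o₀ S prog (n + 1) (.running [] k) Ψ =
      runSamples g₀ o₀ S prog n (.fresh (k false)) (collapse bitIndex 0 Ψ) +
      runSamples g₀ o₀ S prog n (.fresh (k true)) (collapse bitIndex 1 Ψ) :=
  Fin.sum_univ_two (fun i => runSamples g₀ o₀ S prog n (.fresh (k (i = 1))) (collapse bitIndex i Ψ))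

/-- The cost of a protocol on freshly prepared registers. Fewer instructions are left on the
right-hand side, which allows induction on their number although the program need not terminate. -/
theorem runSamples_fresh (hg : ‖g₀‖ = 1) (ho : ‖o₀‖ = 1) (hd : d ∈ stdSimplex ℝ Ω)
    (hS : IsSampler g₀ o₀ d S) (t : Round Ω) (n : ℕ) :
    runSamples g₀ o₀ S prog (n + 1) (.fresh t) (startState g₀ o₀) ≤
      t.expect experimentCost (successProb d) (fun a =>
        runSamples g₀ o₀ S prog n (Memory.ofResult prog a) (startState g₀ o₀)) := by
  have hn := norm_startState hg ho
  have h : ∀ t Ψ, runSamples g₀ o₀ S prog n (.fresh t) Ψ ≤ ENNReal.ofReal (‖Ψ‖ ^ 2) *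
      runSamples g₀ o₀ S prog (n + 1) (.fresh t) (startState g₀ o₀) := fun t Ψ => by
    refine (runSamples_le_succ prog n _ _).trans (le_of_eq ?_)
    rw [runSamples_fresh_eq_start, runSamples_fresh_eq_start prog t n (startState g₀ o₀), hn]
    simp
  induction t with
  | ret a =>
    rw [runSamples_fresh_eq_start, hn]
    simp [Memory.start, Protocol.expect]
  | run e k ih =>
    obtain ⟨h1, h0⟩ := norm_collapse_execute_circuit (α := e.1) hg ho hd hS e.2
    rw [runSamples_fresh_eq_start, hn, one_pow, ENNReal.ofReal_one, one_mul, Memory.start]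
    refine (runSamples_running prog _ _ _ _).trans ?_
    rw [sum_cost_circuit, hn, one_pow, ENNReal.ofReal_one, one_mul]
    refine add_le_add le_rfl ((runSamples_le_succ prog n _ _).trans ?_)
    rw [runSamples_running_nil]
    refine add_le_add ((h _ _).trans ?_) ((h _ _).trans ?_)
    · rw [h0]
      exact mul_le_mul_right (ih false) _
    · rw [h1]
      exact mul_le_mul_right (ih true) _

theorem expectedSamples_compile :
    (compile g₀ o₀ prog).expectedSamples g₀ o₀ S =
      ⨆ n, runSamples g₀ o₀ S prog n (.fresh (prog 0)) (startState g₀ o₀) := rfl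

theorem outputProb_compile_le_one (hg : ‖g₀‖ = 1) (ho : ‖o₀‖ = 1) (T : Set ℝ) :
    (compile g₀ o₀ prog).outputProb g₀ o₀ S T ≤ 1 := by
  have hn : ‖(compile g₀ o₀ prog).initState g₀ o₀‖ = 1 := norm_startState hg ho
  refine iSup_le fun n => ?_
  simpa [hn] using outputWeight_le_norm_sq (compile g₀ o₀ prog) (S := S) hn T n
    (compile g₀ o₀ prog).mem₀ ((compile g₀ o₀ prog).initState g₀ o₀)

end Compile

/-! ### Estimation of Grover angles -/

section Estimation

variable {Ω : Finset ℝ}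

open Protocol

/-- The success frequencies, in `N` runs each, for the given numbers of Grover iterations. -/
noncomputable def sampleFreqs (α : Ω → ℝ) (N : ℕ) : List ℕ → Protocol (Experiment Ω) (List ℝ)
  | [] => ret []
  | m :: ms => (count (α, m) N 0).bind fun c =>
      (sampleFreqs α N ms).bind fun cs => ret ((c : ℝ) / N :: cs)

open Classical in
/-- Some angle in `[0, π / 2]` that is consistent with the frequencies `cs`; the value `0` if there
is none is arbitrary. -/
noncomputable def decodeAngle (ms : List ℕ) (cs : List ℝ) : ℝ :=
  if h : ∃ θ : ℝ, (0 ≤ θ ∧ θ ≤ Real.pi / 2) ∧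
    List.Forall₂ (fun (m : ℕ) (c : ℝ) => |c - Real.sin ((2 * (m : ℝ) + 1) * θ) ^ 2| ≤ 1 / 128) ms cs
  then h.choose else 0

/-- The estimate of `groverAngle d α` up to `2 ^ (-n)`. -/
noncomputable def estimateAngle (α : Ω → ℝ) (n N : ℕ) : Protocol (Experiment Ω) ℝ :=
  (sampleFreqs α N (iterationCounts n)).bind fun cs => ret (decodeAngle (iterationCounts n) cs)

theorem failProb_ret {E β : Type} {p : E → ℝ} {a : β} {S : β → Prop} (h : S a) :
    (ret a : Protocol E β).failProb p S = 0 := by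
  simp [failProb, expect, h]

theorem failProb_sampleFreqs_le (d α : Ω → ℝ) {N : ℕ} (hN : 0 < N) (ms : List ℕ) :
    (sampleFreqs α N ms).failProb (successProb d)
      (List.Forall₂ (fun (m : ℕ) (c : ℝ) => |c - successProb d (α, m)| ≤ 1 / 128) ms) ≤
    ms.length * ENNReal.ofReal (2 * Real.exp (-(N / 65536))) := by
  induction ms with
  | nil => simp [sampleFreqs, failProb_ret]
  | cons m ms ih =>
    rw [sampleFreqs, List.length_cons, Nat.cast_add, add_mul, Nat.cast_one, one_mul]
    refine failProb_bind_le (successProb_mem d) _ _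
      (S := fun c : ℕ => |(c : ℝ) / N - successProb d (α, m)| ≤ 1 / 128) (fun c hc => ?_) ?_
    · rw [← zero_add ((ms.length : ℝ≥0∞) * _)]
      refine failProb_bind_le (successProb_mem d) _ _ (fun cs hcs => ?_) ih
      apply (failProb_ret _).le
      exact List.Forall₂.cons hc hcs
    · refine (failProb_count_le (successProb_mem d) (α, m) hN (by norm_num) (by norm_num)).trans
        (le_of_eq ?_)
      congr 3
      ring

theorem decodeAngle_mem (ms : List ℕ) (cs : List ℝ) :
    0 ≤ decodeAngle ms cs ∧ decodeAngle ms cs ≤ Real.pi / 2 := by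
  unfold decodeAngle
  split_ifs with h
  · exact h.choose_spec.1
  · exact ⟨le_rfl, by positivity⟩

theorem abs_decodeAngle_sub_le {n : ℕ} {cs : List ℝ} {θ : ℝ} (h0 : 0 ≤ θ) (h1 : θ ≤ Real.pi / 2)
    (h : List.Forall₂ (fun (m : ℕ) (c : ℝ) => |c - Real.sin ((2 * (m : ℝ) + 1) * θ) ^ 2| ≤ 1 / 128)
      (iterationCounts n) cs) :
    |decodeAngle (iterationCounts n) cs - θ| ≤ 1 / 2 ^ n := by
  have hex : ∃ θ : ℝ, (0 ≤ θ ∧ θ ≤ Real.pi / 2) ∧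
    List.Forall₂ (fun (m : ℕ) (c : ℝ) => |c - Real.sin ((2 * (m : ℝ) + 1) * θ) ^ 2| ≤ 1 / 128)
      (iterationCounts n) cs := ⟨θ, ⟨h0, h1⟩, h⟩
  obtain ⟨a0, a1⟩ := decodeAngle_mem (iterationCounts n) cs
  have h' : List.Forall₂ (fun (m : ℕ) (c : ℝ) => |c - Real.sin ((2 * (m : ℝ) + 1) *
      decodeAngle (iterationCounts n) cs) ^ 2| ≤ 1 / 128) (iterationCounts n) cs := by
    rw [decodeAngle, dif_pos hex]
    exact hex.choose_spec.2
  refine abs_sub_le_of_sin_sq_close a0 a1 h0 h1 fun m hm => ?_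
  have key : ∀ (x : ℝ) (ms : List ℕ) (cs : List ℝ),
      List.Forall₂ (fun (m : ℕ) (c : ℝ) => |c - Real.sin ((2 * (m : ℝ) + 1) * x) ^ 2| ≤ 1 / 128)
        ms cs →
      List.Forall₂ (fun (m : ℕ) (c : ℝ) => |c - Real.sin ((2 * (m : ℝ) + 1) * θ) ^ 2| ≤ 1 / 128)
        ms cs →
      ∀ m ∈ ms, |Real.sin ((2 * (m : ℝ) + 1) * x) ^ 2 - Real.sin ((2 * (m : ℝ) + 1) * θ) ^ 2| ≤
        1 / 64 := by
    intro x ms cs hx hθ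
    induction hx with
    | nil => simp
    | cons h1 _ ih =>
      cases hθ with
      | cons h2 hθ =>
        intro m hm
        rcases List.mem_cons.1 hm with rfl | hm
        · have h1 := abs_le.1 h1
          have h2 := abs_le.1 h2
          rw [abs_le]
          constructor <;> linarith [h1.1, h1.2, h2.1, h2.2]
        · exact ih hθ m hm
  exact key _ _ _ h' h m hm

theorem failProb_estimateAngle_le (d α : Ω → ℝ) (n : ℕ) {N : ℕ} (hN : 0 < N) :
    (estimateAngle α n N).failProb (successProb d)
      (fun θ => |θ - groverAngle d α| ≤ 1 / 2 ^ n) ≤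
    ENNReal.ofReal ((n + 2) ^ 2 * (2 * Real.exp (-(N / 65536)))) := by
  have h : ((iterationCounts n).length : ℝ≥0∞) * ENNReal.ofReal (2 * Real.exp (-(N / 65536))) ≤
      ENNReal.ofReal ((n + 2) ^ 2 * (2 * Real.exp (-(N / 65536)))) := by
    rw [ENNReal.ofReal_mul (p := ((n : ℝ) + 2) ^ 2) (by positivity)]
    refine mul_le_mul' ?_ le_rfl
    rw [← ENNReal.ofReal_natCast]
    exact ENNReal.ofReal_le_ofReal (by exact_mod_cast length_iterationCounts n)
  refine le_trans ?_ h
  rw [← zero_add ((_ : ℝ≥0∞) * _), estimateAngle]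
  refine failProb_bind_le (successProb_mem d) _ _ (fun cs hcs => ?_)
    (failProb_sampleFreqs_le d α hN (iterationCounts n))
  apply (failProb_ret _).le
  exact abs_decodeAngle_sub_le groverAngle_nonneg groverAngle_le hcs

theorem maxCost_sampleFreqs_le (α : Ω → ℝ) (N : ℕ) {B : ℕ} (ms : List ℕ) (h : ∀ m ∈ ms, m ≤ B) :
    (sampleFreqs α N ms).maxCost experimentCost ≤ ((ms.length * N * (2 * B + 1) : ℕ) : ℝ≥0∞) := by
  induction ms with
  | nil => simp [sampleFreqs, maxCost]
  | cons m ms ih =>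
    have hc : (sampleFreqs α N (m :: ms)).maxCost experimentCost ≤
        (N * (2 * m + 1 : ℕ) : ℝ≥0∞) + (((ms.length * N * (2 * B + 1) : ℕ) : ℝ≥0∞) + 0) := by
      rw [sampleFreqs]
      refine (maxCost_bind_le _ _ _ fun c => (maxCost_bind_le _ _ _ (B := 0) fun cs => ?_).trans
        (add_le_add (ih fun m hm => h m (List.mem_cons_of_mem _ hm)) le_rfl)).trans ?_
      · simp [maxCost]
      · rw [maxCost_count, experimentCost]
    refine hc.trans ?_
    have hm : m ≤ B := h m List.mem_cons_self
    rw [add_zero]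
    norm_cast
    rw [List.length_cons]
    nlinarith [Nat.mul_le_mul_left N hm]

/-- A bound on the number of quantum samples used by `estimateAngle α n N`. -/
def angleCost (n N : ℕ) : ℕ := (n + 2) ^ 2 * N * (5 * 2 ^ n)

theorem maxCost_estimateAngle_le (α : Ω → ℝ) (n N : ℕ) :
    (estimateAngle α n N).maxCost experimentCost ≤ (angleCost n N : ℝ≥0∞) := by
  rw [estimateAngle]
  refine (maxCost_bind_le _ _ _ (B := 0) fun cs => by simp [maxCost]).trans ?_
  rw [add_zero]
  refine (maxCost_sampleFreqs_le α N _ fun m hm => le_of_mem_iterationCounts hm).trans ?_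
  rw [angleCost]
  norm_cast
  refine Nat.mul_le_mul (Nat.mul_le_mul_right _ (length_iterationCounts n)) ?_
  have := Nat.one_le_two_pow (n := n)
  rw [pow_succ]
  omega

theorem abs_sin_sq_sub_sin_sq_le {x y e : ℝ} (h : |x - y| ≤ e) :
    |Real.sin x ^ 2 - Real.sin y ^ 2| ≤ e * (2 * |Real.sin y| + e) := by
  have he : 0 ≤ e := (abs_nonneg _).trans h
  have h1 : |Real.sin x - Real.sin y| ≤ e := by
    have := Real.abs_sin_sub_sin_le x y
    linarith
  have h2 : |Real.sin x + Real.sin y| ≤ 2 * |Real.sin y| + e := by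
    calc |Real.sin x + Real.sin y| = |(Real.sin x - Real.sin y) + 2 * Real.sin y| := by ring_nf
      _ ≤ |Real.sin x - Real.sin y| + |2 * Real.sin y| := abs_add_le _ _
      _ ≤ _ := by rw [abs_mul, abs_two]; linarith
  rw [sq_sub_sq, abs_mul, mul_comm]
  exact mul_le_mul h1 h2 (abs_nonneg _) he

/-! ### Decomposition of a truncated variable into dyadic layers -/

/-- The rotation angles with which the ancilla reads `1` with probability `f x` given `x`, where
`f x ∈ [0, 1]`. -/
noncomputable def fractionAngle (f : ℝ → ℝ) : Ω → ℝ := fun x => Real.arcsin (Real.sqrt (f x))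

/-- The expectation of `f`. -/
def average (d : Ω → ℝ) (f : ℝ → ℝ) : ℝ := ∑ x : Ω, d x * f x

theorem hitProb_fractionAngle (d : Ω → ℝ) {f : ℝ → ℝ} (hf : ∀ x ∈ Ω, 0 ≤ f x ∧ f x ≤ 1) :
    hitProb d (fractionAngle f) = average d f := by
  refine Finset.sum_congr rfl fun x _ => ?_
  obtain ⟨h0, h1⟩ := hf x x.2
  rw [fractionAngle, Real.sin_arcsin (by linarith [Real.sqrt_nonneg (f x)])
    (Real.sqrt_le_one.2 h1), Real.sq_sqrt h0]

/-- The dyadic layers of `x` above the scale `b`, normalised to values in `[0, 1]`: `layer b 0` is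
the part of `x` below `b`, and `layer b (l + 1)` the part between `b 2 ^ l` and `b 2 ^ (l + 1)`. -/
noncomputable def layer (b : ℝ) : ℕ → ℝ → ℝ
  | 0, x => min x b / b
  | l + 1, x => (min x (b * 2 ^ (l + 1)) - min x (b * 2 ^ l)) / (b * 2 ^ (l + 1))

theorem layer_mem {b : ℝ} (hb : 0 < b) (l : ℕ) {x : ℝ} (hx : 0 ≤ x) :
    0 ≤ layer b l x ∧ layer b l x ≤ 1 := by
  cases l with
  | zero =>
    simp only [layer]
    exact ⟨by positivity, by rw [div_le_one hb]; exact min_le_right _ _⟩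
  | succ l =>
    simp only [layer]
    have h1 : min x (b * 2 ^ l) ≤ min x (b * 2 ^ (l + 1)) :=
      min_le_min_left x (by rw [pow_succ]; nlinarith [pow_pos (two_pos (α := ℝ)) l])
    have h2 : 0 ≤ min x (b * 2 ^ l) := le_min hx (by positivity)
    constructor
    · exact div_nonneg (by linarith) (by positivity)
    · rw [div_le_one (by positivity)]
      linarith [min_le_right x (b * 2 ^ (l + 1))]

theorem sum_layer {b : ℝ} (hb : 0 < b) (L : ℕ) (x : ℝ) :
    ∑ l ∈ Finset.range (L + 1), b * 2 ^ l * layer b l x = min x (b * 2 ^ L) := by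
  induction L with
  | zero => simp [layer]; field_simp
  | succ L ih =>
    rw [Finset.sum_range_succ, ih, layer]
    field_simp
    ring

theorem sum_average_layer (d : Ω → ℝ) {b : ℝ} (hb : 0 < b) (L : ℕ) :
    ∑ l ∈ Finset.range (L + 1), b * 2 ^ l * average d (layer b l) =
      average d (fun x => min x (b * 2 ^ L)) := by
  simp only [average, Finset.mul_sum]
  rw [Finset.sum_comm]
  refine Finset.sum_congr rfl fun x _ => ?_
  rw [← sum_layer hb, Finset.mul_sum]
  refine Finset.sum_congr rfl fun l _ => by ring

theorem average_mono {d : Ω → ℝ} (hd : d ∈ stdSimplex ℝ Ω) {f g : ℝ → ℝ}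
    (h : ∀ x ∈ Ω, f x ≤ g x) : average d f ≤ average d g :=
  Finset.sum_le_sum fun x _ => mul_le_mul_of_nonneg_left (h x x.2) (hd.1 x)

theorem average_nonneg {d : Ω → ℝ} (hd : d ∈ stdSimplex ℝ Ω) {f : ℝ → ℝ}
    (h : ∀ x ∈ Ω, 0 ≤ f x) : 0 ≤ average d f :=
  Finset.sum_nonneg fun x _ => mul_nonneg (hd.1 x) (h x x.2)

/-- The estimate of the mean of the sum of the first `L` layers. -/
noncomputable def estimateLayers (b : ℝ) (n N : ℕ) : ℕ → Protocol (Experiment Ω) ℝ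
  | 0 => ret 0
  | L + 1 => (estimateAngle (fractionAngle (layer b L)) n N).bind fun θ =>
      (estimateLayers b n N L).bind fun s => ret (s + b * 2 ^ L * Real.sin θ ^ 2)

theorem maxCost_estimateLayers_le (b : ℝ) (n N L : ℕ) :
    (estimateLayers (Ω := Ω) b n N L).maxCost experimentCost ≤
      ((L * angleCost n N : ℕ) : ℝ≥0∞) := by
  induction L with
  | zero => simp [estimateLayers, maxCost]
  | succ L ih =>
    rw [estimateLayers]
    refine (maxCost_bind_le _ _ _ fun θ => (maxCost_bind_le _ _ _ (B := 0) fun s => by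
      simp [maxCost]).trans (add_le_add ih le_rfl)).trans ?_
    refine (add_le_add (maxCost_estimateAngle_le _ n N) le_rfl).trans (le_of_eq ?_)
    push_cast
    ring

theorem abs_sin_sq_sub_average_le {d : Ω → ℝ} (hd : d ∈ stdSimplex ℝ Ω) {f : ℝ → ℝ}
    (hf : ∀ x ∈ Ω, 0 ≤ f x ∧ f x ≤ 1) {θ e : ℝ}
    (h : |θ - groverAngle d (fractionAngle f)| ≤ e) :
    |Real.sin θ ^ 2 - average d f| ≤ e * (2 * Real.sqrt (average d f) + e) := by
  have := abs_sin_sq_sub_sin_sq_le h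
  rwa [← Real.sqrt_sq_eq_abs (Real.sin (groverAngle _ _)), sin_groverAngle_sq hd,
    hitProb_fractionAngle d hf] at this

theorem failProb_estimateLayers_le (hΩ : ∀ x ∈ Ω, 0 ≤ x) {d : Ω → ℝ} (hd : d ∈ stdSimplex ℝ Ω)
    {b : ℝ} (hb : 0 < b) (n : ℕ) {N : ℕ} (hN : 0 < N) (L : ℕ) :
    (estimateLayers b n N L).failProb (successProb d) (fun s =>
      |s - ∑ l ∈ Finset.range L, b * 2 ^ l * average d (layer b l)| ≤
        ∑ l ∈ Finset.range L, b * 2 ^ l *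
          ((1 / 2 ^ n) * (2 * Real.sqrt (average d (layer b l)) + 1 / 2 ^ n))) ≤
    L * ENNReal.ofReal ((n + 2) ^ 2 * (2 * Real.exp (-(N / 65536)))) := by
  induction L with
  | zero => simp [estimateLayers, failProb_ret]
  | succ L ih =>
    rw [estimateLayers, Nat.cast_add, add_mul, Nat.cast_one, one_mul]
    refine failProb_bind_le (successProb_mem d) _ _ (fun θ hθ => ?_)
      (failProb_estimateAngle_le d _ n hN)
    rw [← zero_add ((L : ℝ≥0∞) * _)]
    refine failProb_bind_le (successProb_mem d) _ _ (fun s hs => ?_) ih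
    apply (failProb_ret _).le
    rw [Finset.sum_range_succ, Finset.sum_range_succ]
    have h1 := abs_sin_sq_sub_average_le hd (fun x hx => layer_mem hb L (hΩ x hx)) hθ
    have hbL : 0 < b * 2 ^ L := by positivity
    calc _ = |(s - ∑ l ∈ Finset.range L, b * 2 ^ l * average d (layer b l)) +
          b * 2 ^ L * (Real.sin θ ^ 2 - average d (layer b L))| := by ring_nf
      _ ≤ _ := (abs_add_le _ _).trans (add_le_add hs (by
          rw [abs_mul, abs_of_pos hbL]; gcongr))

end Estimation

/-! ### Bounds by the second moment -/

section Moments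

variable {Ω : Finset ℝ} {d : Ω → ℝ}

theorem mean_eq_average (d : Ω → ℝ) : mean d = average d (fun x => x) := rfl

theorem average_sub (d : Ω → ℝ) (f g : ℝ → ℝ) :
    average d (fun x => f x - g x) = average d f - average d g := by
  rw [average, average, average, ← Finset.sum_sub_distrib]
  exact Finset.sum_congr rfl fun x _ => by ring

theorem average_div (d : Ω → ℝ) (f : ℝ → ℝ) (c : ℝ) :
    average d (fun x => f x / c) = average d f / c := by
  rw [average, average, Finset.sum_div]
  exact Finset.sum_congr rfl fun x _ => by ring

theorem average_min_le_mean (hd : d ∈ stdSimplex ℝ Ω) (a : ℝ) :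
    average d (fun x => min x a) ≤ mean d :=
  average_mono hd fun _ _ => min_le_left _ _

theorem sub_min_le_sq_div {x a : ℝ} (ha : 0 < a) : x - min x a ≤ x ^ 2 / a := by
  rcases le_total x a with h | h
  · rw [min_eq_left h, sub_self]; positivity
  · rw [min_eq_right h, le_div_iff₀ ha]; nlinarith

theorem mean_sub_average_min_le (hd : d ∈ stdSimplex ℝ Ω) {a : ℝ} (ha : 0 < a) :
    mean d - average d (fun x => min x a) ≤ average d (fun x => x ^ 2) / a := by
  rw [mean_eq_average, ← average_sub, ← average_div]
  exact average_mono hd fun x _ => sub_min_le_sq_div ha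

theorem average_layer_zero_le (hd : d ∈ stdSimplex ℝ Ω) {b : ℝ} (hb : 0 < b) :
    average d (layer b 0) ≤ mean d / b := by
  have : average d (layer b 0) = average d (fun x => min x b / b) := rfl
  rw [this, average_div]
  gcongr
  exact average_min_le_mean hd b

theorem layer_zero_antitone {a b x : ℝ} (ha : 0 < a) (hab : a ≤ b) (hx : 0 ≤ x) :
    layer b 0 x ≤ layer a 0 x := by
  have hb : 0 < b := ha.trans_le hab
  simp only [layer]
  rw [← min_div_div_right hb.le, ← min_div_div_right ha.le, div_self hb.ne', div_self ha.ne']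
  gcongr

theorem le_average_layer_zero (hΩ : ∀ x ∈ Ω, 0 ≤ x) (hd : d ∈ stdSimplex ℝ Ω) {D : ℝ}
    (hD : 0 < D) (hμ : 0 < mean d) (hφ : average d (fun x => x ^ 2) ≤ D ^ 2 * mean d ^ 2)
    {b : ℝ} (hb : 0 < b) (hb2 : b ≤ 2 * D ^ 2 * mean d) :
    1 / (4 * D ^ 2) ≤ average d (layer b 0) := by
  set c := 2 * D ^ 2 * mean d with hc
  have hc0 : 0 < c := by positivity
  have h1 : average d (layer c 0) ≤ average d (layer b 0) :=
    average_mono hd fun x hx => layer_zero_antitone hb hb2 (hΩ x hx)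
  refine le_trans ?_ h1
  have h2 : average d (layer c 0) = average d (fun x => min x c) / c := average_div _ _ _
  have h3 := mean_sub_average_min_le hd hc0
  have h4 : average d (fun x => x ^ 2) / c ≤ mean d / 2 := by
    rw [div_le_iff₀ hc0, hc]
    nlinarith
  rw [h2, le_div_iff₀ hc0]
  have h5 : 1 / (4 * D ^ 2) * c = mean d / 2 := by rw [hc]; field_simp; norm_num
  linarith

theorem sq_mul_average_layer_le (hd : d ∈ stdSimplex ℝ Ω) {D : ℝ}
    (hμ : 0 < mean d) (hφ : average d (fun x => x ^ 2) ≤ D ^ 2 * mean d ^ 2)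
    {b : ℝ} (hb : 0 < b) (hb2 : b ≤ 64 * D ^ 2 * mean d) (l : ℕ) :
    (b * 2 ^ l) ^ 2 * average d (layer b l) ≤ 64 * D ^ 2 * mean d ^ 2 := by
  cases l with
  | zero =>
    have h := average_layer_zero_le hd hb
    rw [le_div_iff₀ hb] at h
    rw [pow_zero, mul_one]
    nlinarith
  | succ l =>
    set a := b * 2 ^ l with ha
    have ha0 : 0 < a := by positivity
    have h2a : b * 2 ^ (l + 1) = 2 * a := by rw [ha, pow_succ]; ring
    have h1 : average d (layer b (l + 1)) =
        average d (fun x => min x (2 * a) - min x a) / (2 * a) := by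
      rw [← h2a, ← average_div]; rfl
    have h2 : average d (fun x => min x (2 * a) - min x a) ≤ average d (fun x => x ^ 2) / a := by
      rw [← average_div]
      exact average_mono hd fun x _ => (sub_le_sub_right (min_le_left _ _) _).trans
        (sub_min_le_sq_div ha0)
    rw [le_div_iff₀ ha0] at h2
    rw [h2a, h1]
    have h3 : (2 * a) ^ 2 * (average d (fun x => min x (2 * a) - min x a) / (2 * a)) =
        2 * (average d (fun x => min x (2 * a) - min x a) * a) := by
      field_simp
    rw [h3]
    nlinarith [sq_nonneg (D * mean d)]

theorem mul_sqrt_average_layer_le (hΩ : ∀ x ∈ Ω, 0 ≤ x) (hd : d ∈ stdSimplex ℝ Ω) {D : ℝ}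
    (hD : 0 < D)
    (hμ : 0 < mean d) (hφ : average d (fun x => x ^ 2) ≤ D ^ 2 * mean d ^ 2)
    {b : ℝ} (hb : 0 < b) (hb2 : b ≤ 64 * D ^ 2 * mean d) (l : ℕ) :
    b * 2 ^ l * Real.sqrt (average d (layer b l)) ≤ 8 * D * mean d := by
  have h := sq_mul_average_layer_le hd hμ hφ hb hb2 l
  have h0 : 0 ≤ average d (layer b l) := average_nonneg hd fun x hx => (layer_mem hb l (hΩ x hx)).1
  refine le_of_sq_le_sq ?_ (by positivity)
  rw [mul_pow, Real.sq_sqrt h0]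
  linarith

theorem sum_two_pow_le (L : ℕ) : ∑ l ∈ Finset.range (L + 1), (2 : ℝ) ^ l ≤ 2 * 2 ^ L := by
  induction L with
  | zero => simp
  | succ L ih => rw [Finset.sum_range_succ, pow_succ]; linarith

/-- If all angles of the layers are known up to `e`, the resulting sum estimates the mean up to the
relative error `ε`: the truncation costs `ε / 4`, the terms linear in `e` cost `ε / 4`, and the
quadratic ones at most `ε / 2`. -/
theorem layer_error_le (hΩ : ∀ x ∈ Ω, 0 ≤ x) (hd : d ∈ stdSimplex ℝ Ω) {D : ℝ}
    (hD : 0 < D) (hμ : 0 < mean d) (hφ : average d (fun x => x ^ 2) ≤ D ^ 2 * mean d ^ 2)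
    {b : ℝ} (hb : D ^ 2 * mean d ≤ b) (hb2 : b ≤ 64 * D ^ 2 * mean d)
    {ε e : ℝ} (hε : 0 < ε) {L : ℕ} (hL : 4 / ε ≤ 2 ^ L)
    (hL2 : 2 ^ L ≤ 10 / ε) (he0 : 0 ≤ e) (he : e * (64 * D * (L + 1)) ≤ ε) {s : ℝ}
    (hs : |s - ∑ l ∈ Finset.range (L + 1), b * 2 ^ l * average d (layer b l)| ≤
        ∑ l ∈ Finset.range (L + 1), b * 2 ^ l *
          (e * (2 * Real.sqrt (average d (layer b l)) + e))) :
    |s - mean d| ≤ ε * mean d := by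
  have hDμ : 0 < D ^ 2 * mean d := by positivity
  have hb0 : 0 < b := hDμ.trans_le hb
  have ha0 : 0 < b * 2 ^ L := by positivity
  rw [sum_average_layer d hb0] at hs
  set t := average d (fun x => min x (b * 2 ^ L)) with ht
  have ht1 : t ≤ mean d := average_min_le_mean hd _
  have ht2 : mean d - t ≤ ε / 4 * mean d := by
    refine (mean_sub_average_min_le hd ha0).trans ?_
    rw [div_le_iff₀ ha0]
    have h1 : D ^ 2 * mean d * (4 / ε) ≤ b * 2 ^ L := by gcongr
    calc average d (fun x => x ^ 2) ≤ D ^ 2 * mean d ^ 2 := hφ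
      _ = ε / 4 * mean d * (D ^ 2 * mean d * (4 / ε)) := by field_simp
      _ ≤ _ := by gcongr
  have hsum : ∑ l ∈ Finset.range (L + 1), b * 2 ^ l *
      (e * (2 * Real.sqrt (average d (layer b l)) + e)) ≤
      (L + 1) * (16 * D * mean d * e) + e ^ 2 * b * (2 * 2 ^ L) := by
    calc _ ≤ ∑ l ∈ Finset.range (L + 1), (16 * D * mean d * e + e ^ 2 * b * 2 ^ l) := by
          refine Finset.sum_le_sum fun l _ => ?_
          have h := mul_sqrt_average_layer_le hΩ hd hD hμ hφ hb0 hb2 l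
          nlinarith [mul_le_mul_of_nonneg_left h he0]
      _ = (L + 1) * (16 * D * mean d * e) + e ^ 2 * b *
            ∑ l ∈ Finset.range (L + 1), (2 : ℝ) ^ l := by
          rw [Finset.sum_add_distrib, Finset.sum_const, Finset.card_range, ← Finset.mul_sum]
          simp
      _ ≤ _ := by gcongr; exact sum_two_pow_le L
  have h1 : (L + 1) * (16 * D * mean d * e) ≤ ε / 4 * mean d := by
    nlinarith [mul_le_mul_of_nonneg_right he hμ.le]
  have h2 : e ^ 2 * b * (2 * 2 ^ L) ≤ ε / 2 * mean d := by
    have he' : e * (64 * D) ≤ ε := by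
      refine le_trans ?_ he
      have : (0 : ℝ) ≤ L := Nat.cast_nonneg L
      nlinarith [mul_nonneg (mul_nonneg he0 hD.le) this]
    have hsq : (e * (64 * D)) ^ 2 ≤ ε ^ 2 := by gcongr
    calc e ^ 2 * b * (2 * 2 ^ L) ≤ e ^ 2 * (64 * D ^ 2 * mean d) * (2 * (10 / ε)) := by gcongr
      _ = (e * (64 * D)) ^ 2 * (5 / 16 / ε * mean d) := by field_simp; ring
      _ ≤ ε ^ 2 * (5 / 16 / ε * mean d) := by gcongr
      _ = 5 / 16 * (ε * mean d) := by field_simp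
      _ ≤ _ := by nlinarith [mul_pos hε hμ]
  have h3 := abs_le.1 (hs.trans hsum)
  have h4 := mul_pos hε hμ
  rw [abs_le]
  constructor <;> linarith [h3.1, h3.2]

/-! ### The threshold test -/

theorem sin_groverAngle_fractionAngle (hd : d ∈ stdSimplex ℝ Ω) {f : ℝ → ℝ}
    (hf : ∀ x ∈ Ω, 0 ≤ f x ∧ f x ≤ 1) :
    Real.sin (groverAngle d (fractionAngle f)) = Real.sqrt (average d f) := by
  rw [← hitProb_fractionAngle d hf, ← sin_groverAngle_sq hd, Real.sqrt_sq]
  exact Real.sin_nonneg_of_nonneg_of_le_pi groverAngle_nonneg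
    (groverAngle_le.trans (by linarith [Real.pi_pos]))

/-- The angle is at least `√(𝔼 f) ≥ 1 / (2 D)`, and the estimate is off by at most
`1 / (16 D)`. -/
theorem le_of_close_of_le_average (hd : d ∈ stdSimplex ℝ Ω) {f : ℝ → ℝ}
    (hf : ∀ x ∈ Ω, 0 ≤ f x ∧ f x ≤ 1) {D : ℝ} (hD : 0 < D)
    (h : 1 / (4 * D ^ 2) ≤ average d f) {θ : ℝ}
    (hθ : |θ - groverAngle d (fractionAngle f)| ≤ 1 / (16 * D)) : 3 / (8 * D) ≤ θ := by
  have h1 : 1 / (2 * D) ≤ Real.sqrt (average d f) := by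
    apply Real.le_sqrt_of_sq_le
    refine le_trans (le_of_eq ?_) h
    field_simp
    norm_num
  have h2 := Real.sin_le (groverAngle_nonneg (d := d) (α := fractionAngle f))
  rw [sin_groverAngle_fractionAngle hd hf] at h2
  have h3 := (abs_le.1 hθ).1
  have h4 : 3 / (8 * D) = 6 * (1 / (16 * D)) := by field_simp; norm_num
  have h5 : 1 / (2 * D) = 8 * (1 / (16 * D)) := by field_simp; norm_num
  have h6 : 0 < 1 / (16 * D) := by positivity
  linarith

/-- If `𝔼 f ≤ 1 / (64 D ^ 2)`, the angle is at most `π / 2 · √(𝔼 f) ≤ π / (16 D)`, and the estimate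
stays below the threshold. -/
theorem lt_average_of_close_of_le (hd : d ∈ stdSimplex ℝ Ω) {f : ℝ → ℝ}
    (hf : ∀ x ∈ Ω, 0 ≤ f x ∧ f x ≤ 1) {D : ℝ} (hD : 0 < D) {θ : ℝ}
    (hθ : |θ - groverAngle d (fractionAngle f)| ≤ 1 / (16 * D)) (h : 3 / (8 * D) ≤ θ) :
    1 / (64 * D ^ 2) < average d f := by
  by_contra! hc
  have h1 : Real.sqrt (average d f) ≤ 1 / (8 * D) := by
    apply Real.sqrt_le_iff.2 ⟨by positivity, hc.trans (le_of_eq ?_)⟩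
    field_simp
    norm_num
  have h2 := Real.mul_le_sin (groverAngle_nonneg (d := d) (α := fractionAngle f)) groverAngle_le
  rw [sin_groverAngle_fractionAngle hd hf, div_mul_eq_mul_div, div_le_iff₀ Real.pi_pos] at h2
  have h3 := (abs_le.1 hθ).2
  have h4 : 3 / (8 * D) = 6 * (1 / (16 * D)) := by field_simp; norm_num
  have h5 : 1 / (8 * D) = 2 * (1 / (16 * D)) := by field_simp; norm_num
  have h6 : 0 < 1 / (16 * D) := by positivity
  have h7 := mul_le_mul h1 Real.pi_lt_four.le Real.pi_pos.le (by positivity)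
  linarith

end Moments

open Protocol

/-! ### Parameters of the algorithm -/

/-- The number of repetitions of each experiment with which `estimateAngle` of precision `n` fails
with probability at most `η`. -/
noncomputable def repetitions (n : ℕ) (η : ℝ) : ℕ :=
  ⌈65536 * Real.log (2 * (n + 2) ^ 2 / η)⌉₊ + 1

theorem repetitions_pos (n : ℕ) (η : ℝ) : 0 < repetitions n η := Nat.succ_pos _

theorem mul_exp_repetitions_le (n : ℕ) {η : ℝ} (hη : 0 < η) :
    ((n : ℝ) + 2) ^ 2 * (2 * Real.exp (-((repetitions n η : ℕ) / 65536 : ℝ))) ≤ η := by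
  have h1 : 65536 * Real.log (2 * (n + 2) ^ 2 / η) ≤ (repetitions n η : ℕ) := by
    refine (Nat.le_ceil _).trans ?_
    exact Nat.cast_le.2 (Nat.le_succ _)
  have h2 : Real.exp (-((repetitions n η : ℕ) / 65536 : ℝ)) ≤ η / (2 * (n + 2) ^ 2) := by
    have h3 : Real.log (2 * (n + 2) ^ 2 / η) ≤ (repetitions n η : ℕ) / 65536 := by
      rw [le_div_iff₀ (by norm_num)]; linarith
    calc _ ≤ Real.exp (-Real.log (2 * (n + 2) ^ 2 / η)) := Real.exp_le_exp.2 (by linarith)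
      _ = _ := by rw [← Real.log_inv, Real.exp_log (by positivity), inv_div]
  calc _ ≤ ((n : ℝ) + 2) ^ 2 * (2 * (η / (2 * (n + 2) ^ 2))) := by gcongr
    _ = η := by field_simp

/-- The scale `b` tested in the `j`-th round. -/
noncomputable def searchLevel (Δ : ℕ) (H : ℝ) (j : ℕ) : ℝ := 2 * (Δ : ℝ) ^ 2 * H / 2 ^ j

/-- The precision of the angle in the threshold test. -/
def searchPrecision (Δ : ℕ) : ℕ := Nat.clog 2 (16 * Δ)

/-- The index `L` of the last layer; it satisfies `4 / ε ≤ 2 ^ L`. -/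
noncomputable def lastLayer (ε : ℝ) : ℕ := Nat.clog 2 ⌈4 / ε⌉₊

/-- The precision of the angles of the layers. -/
noncomputable def layerPrecision (Δ : ℕ) (ε : ℝ) : ℕ :=
  Nat.clog 2 ⌈64 * (Δ : ℝ) * (lastLayer ε + 1) / ε⌉₊

theorem two_pow_clog_le {x : ℕ} (hx : 1 ≤ x) : 2 ^ Nat.clog 2 x ≤ 2 * x := by
  rcases hx.eq_or_lt with rfl | hx
  · simp
  · have h := Nat.pow_pred_clog_lt_self (b := 2) (by norm_num) hx
    have hpos : 0 < Nat.clog 2 x := Nat.clog_pos (by norm_num) hx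
    obtain ⟨c, hc⟩ := Nat.exists_eq_succ_of_ne_zero hpos.ne'
    rw [hc] at h ⊢
    simp only [Nat.succ_eq_add_one, Nat.pred_succ] at h
    rw [Nat.succ_eq_add_one, pow_succ]
    omega

theorem le_two_pow_clog_ceil (y : ℝ) : y ≤ 2 ^ Nat.clog 2 ⌈y⌉₊ :=
  (Nat.le_ceil y).trans (by exact_mod_cast Nat.le_pow_clog (by norm_num) _)

theorem two_pow_clog_ceil_le {y : ℝ} (hy : 0 < y) : (2 : ℝ) ^ Nat.clog 2 ⌈y⌉₊ ≤ 2 * (y + 1) := by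
  have h1 : 1 ≤ ⌈y⌉₊ := Nat.ceil_pos.2 hy
  have h2 : ((2 ^ Nat.clog 2 ⌈y⌉₊ : ℕ) : ℝ) ≤ ((2 * ⌈y⌉₊ : ℕ) : ℝ) :=
    Nat.cast_le.2 (two_pow_clog_le h1)
  push_cast at h2
  linarith [(Nat.ceil_lt_add_one hy.le).le]

/-! ### The rounds of the search -/

section Program

variable {Ω : Finset ℝ}

/-- The `j`-th round: test the scale `searchLevel Δ H j`; go on with the next round if it is
rejected, otherwise output the estimate at this scale. -/
noncomputable def searchRound (Δ : ℕ) (H ε δ : ℝ) (j : ℕ) : Round Ω :=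
  (estimateAngle (fractionAngle (layer (searchLevel Δ H j) 0)) (searchPrecision Δ)
      (repetitions (searchPrecision Δ) (δ / 8 / 2 ^ j))).bind fun θ =>
    if θ < 3 / (8 * (Δ : ℝ)) then ret (.inr (j + 1))
    else (estimateLayers (searchLevel Δ H j) (layerPrecision Δ ε)
      (repetitions (layerPrecision Δ ε) (δ / (4 * (lastLayer ε + 1))))
      (lastLayer ε + 1)).bind fun s => ret (.inl s)

/-- A bound on the number of quantum samples used in the `j`-th round. -/
noncomputable def roundCost (Δ : ℕ) (ε δ : ℝ) (j : ℕ) : ℕ :=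
  angleCost (searchPrecision Δ) (repetitions (searchPrecision Δ) (δ / 8 / 2 ^ j)) +
    (lastLayer ε + 1) * angleCost (layerPrecision Δ ε)
      (repetitions (layerPrecision Δ ε) (δ / (4 * (lastLayer ε + 1))))

theorem maxCost_searchRound_le (Δ : ℕ) (H ε δ : ℝ) (j : ℕ) :
    (searchRound (Ω := Ω) Δ H ε δ j).maxCost experimentCost ≤ (roundCost Δ ε δ j : ℝ≥0∞) := by
  rw [searchRound, roundCost, Nat.cast_add]
  refine (maxCost_bind_le _ _ _ fun θ => ?_).trans
    (add_le_add (maxCost_estimateAngle_le _ _ _) le_rfl)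
  split_ifs
  · simp [maxCost]
  · refine (maxCost_bind_le _ _ _ (B := 0) fun s => by simp [maxCost]).trans ?_
    rw [add_zero]
    exact maxCost_estimateLayers_le _ _ _ _

theorem expect_searchRound (Δ : ℕ) (H ε δ : ℝ) (j : ℕ) (p : Experiment Ω → ℝ)
    (F : ℝ ⊕ ℕ → ℝ≥0∞) :
    (searchRound Δ H ε δ j).expect 0 p F =
      (estimateAngle (fractionAngle (layer (searchLevel Δ H j) 0)) (searchPrecision Δ)
        (repetitions (searchPrecision Δ) (δ / 8 / 2 ^ j))).expect 0 p fun θ =>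
      if θ < 3 / (8 * (Δ : ℝ)) then F (.inr (j + 1))
      else (estimateLayers (searchLevel Δ H j) (layerPrecision Δ ε)
        (repetitions (layerPrecision Δ ε) (δ / (4 * (lastLayer ε + 1))))
        (lastLayer ε + 1)).expect 0 p fun s => F (.inl s) := by
  rw [searchRound, expect_bind]
  congr 1
  funext θ
  split_ifs
  · rfl
  · rw [expect_bind]; rfl

variable {d : Ω → ℝ} {Δ : ℕ} {H ε δ : ℝ}

theorem failProb_search_le (d : Ω → ℝ) (hΔ : 0 < Δ) (hδ : 0 < δ) (H : ℝ) (j : ℕ) :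
    (estimateAngle (fractionAngle (layer (searchLevel Δ H j) 0)) (searchPrecision Δ)
      (repetitions (searchPrecision Δ) (δ / 8 / 2 ^ j))).failProb (successProb d)
      (fun θ => |θ - groverAngle d (fractionAngle (layer (searchLevel Δ H j) 0))| ≤
        1 / (16 * (Δ : ℝ))) ≤ ENNReal.ofReal (δ / 8 / 2 ^ j) := by
  refine (failProb_mono _ fun θ hθ => hθ.trans ?_).trans
    ((failProb_estimateAngle_le d _ (searchPrecision Δ) (repetitions_pos _ _)).trans
    (ENNReal.ofReal_le_ofReal (mul_exp_repetitions_le _ (by positivity))))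
  have h : ((16 * Δ : ℕ) : ℝ) ≤ ((2 ^ searchPrecision Δ : ℕ) : ℝ) :=
    Nat.cast_le.2 (Nat.le_pow_clog (by norm_num) _)
  push_cast at h
  exact one_div_le_one_div_of_le (by positivity) h

theorem failProb_layers_le (hΩ : ∀ x ∈ Ω, 0 ≤ x) (hd : d ∈ stdSimplex ℝ Ω)
    (hΔ : 0 < Δ) (hε : 0 < ε) (hε1 : ε < 1) (hδ : 0 < δ) (hμ : 0 < mean d)
    (hφ : average d (fun x => x ^ 2) ≤ (Δ : ℝ) ^ 2 * mean d ^ 2) {b : ℝ}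
    (hb : (Δ : ℝ) ^ 2 * mean d ≤ b) (hb2 : b ≤ 64 * (Δ : ℝ) ^ 2 * mean d) :
    (estimateLayers b (layerPrecision Δ ε)
        (repetitions (layerPrecision Δ ε) (δ / (4 * (lastLayer ε + 1))))
        (lastLayer ε + 1)).failProb (successProb d) (fun s => |s - mean d| ≤ ε * mean d) ≤
      ENNReal.ofReal (δ / 4) := by
  have hΔ' : (0 : ℝ) < Δ := by exact_mod_cast hΔ
  have hb0 : 0 < b := lt_of_lt_of_le (by positivity) hb
  have hL2 : (2 : ℝ) ^ lastLayer ε ≤ 10 / ε := by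
    refine (two_pow_clog_ceil_le (by positivity)).trans ?_
    rw [mul_add, le_div_iff₀ hε, add_mul, mul_assoc, div_mul_cancel₀ _ hε.ne']
    linarith
  have he : 1 / 2 ^ layerPrecision Δ ε * (64 * (Δ : ℝ) * ((lastLayer ε : ℕ) + 1)) ≤ ε := by
    have h := le_two_pow_clog_ceil (64 * (Δ : ℝ) * (lastLayer ε + 1) / ε)
    rw [div_le_iff₀ hε] at h
    rw [one_div_mul_eq_div, div_le_iff₀ (by positivity), mul_comm ε]
    exact h
  have key := failProb_estimateLayers_le hΩ hd hb0 (layerPrecision Δ ε)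
    (repetitions_pos (layerPrecision Δ ε) (δ / (4 * (lastLayer ε + 1)))) (lastLayer ε + 1)
  refine (failProb_mono _ fun s hs => layer_error_le hΩ hd hΔ' hμ hφ hb hb2 hε
    (le_two_pow_clog_ceil _) hL2 (by positivity) he hs).trans (key.trans ?_)
  calc _ ≤ ((lastLayer ε + 1 : ℕ) : ℝ≥0∞) * ENNReal.ofReal (δ / (4 * (lastLayer ε + 1))) := by
        gcongr
        exact mul_exp_repetitions_le _ (by positivity)
    _ = _ := by
        rw [← ENNReal.ofReal_natCast, ← ENNReal.ofReal_mul (by positivity)]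
        congr 1
        push_cast
        field_simp

end Program

/-! ### Correctness, termination and cost of the search -/

section Correctness

variable {Ω : Finset ℝ} {G : Type u} [NormedAddCommGroup G] [InnerProductSpace ℂ G]
  {g₀ : G} {o₀ : EuclideanSpace ℂ Ω} {S : SampleSpace Ω G ≃ₗᵢ[ℂ] SampleSpace Ω G}
  {d : Ω → ℝ} {Δ : ℕ} {H ε δ : ℝ}

/-- The standing assumptions of the analysis. Here `J` is the least `j` with `H / 2 ^ j ≤ mean d`,
the first round in which the test has to accept. -/
structure Setting (g₀ : G) (o₀ : EuclideanSpace ℂ Ω)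
    (S : SampleSpace Ω G ≃ₗᵢ[ℂ] SampleSpace Ω G) (d : Ω → ℝ) (Δ : ℕ) (H ε δ : ℝ) (J : ℕ) :
    Prop where
  nonneg : ∀ x ∈ Ω, 0 ≤ x
  norm_g : ‖g₀‖ = 1
  norm_o : ‖o₀‖ = 1
  dist : d ∈ stdSimplex ℝ Ω
  sampler : IsSampler g₀ o₀ d S
  Δ_pos : 0 < Δ
  H_pos : 0 < H
  ε_pos : 0 < ε
  ε_lt : ε < 1
  δ_pos : 0 < δ
  δ_lt : δ < 1
  mean_pos : 0 < mean d
  moment : average d (fun x => x ^ 2) ≤ (Δ : ℝ) ^ 2 * mean d ^ 2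
  level_le : ∀ j, J ≤ j → H / 2 ^ j ≤ mean d
  lt_level : ∀ j, j < J → mean d < H / 2 ^ j
  le_level : mean d / 2 ≤ H / 2 ^ J

variable {J : ℕ} (h : Setting g₀ o₀ S d Δ H ε δ J)
include h

theorem Setting.searchLevel_pos (j : ℕ) : 0 < searchLevel Δ H j := by
  have h1 := h.H_pos
  have h2 : (0 : ℝ) < Δ := by exact_mod_cast h.Δ_pos
  rw [searchLevel]; positivity

omit h in
theorem searchLevel_eq (Δ : ℕ) (H : ℝ) (j : ℕ) :
    searchLevel Δ H j = 2 * (Δ : ℝ) ^ 2 * (H / 2 ^ j) := by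
  rw [searchLevel, mul_div_assoc]

theorem Setting.layer_zero_mem (j : ℕ) : ∀ x ∈ Ω, 0 ≤ layer (searchLevel Δ H j) 0 x ∧
    layer (searchLevel Δ H j) 0 x ≤ 1 :=
  fun x hx => layer_mem (h.searchLevel_pos j) 0 (h.nonneg x hx)

/-- From round `J` on a successful angle estimate leads to acceptance. -/
theorem Setting.le_of_close {j : ℕ} (hj : J ≤ j) {θ : ℝ}
    (hθ : |θ - groverAngle d (fractionAngle (layer (searchLevel Δ H j) 0))| ≤
        1 / (16 * (Δ : ℝ))) : ¬ θ < 3 / (8 * (Δ : ℝ)) := by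
  have h2 : (0 : ℝ) < Δ := by exact_mod_cast h.Δ_pos
  rw [not_lt]
  refine le_of_close_of_le_average h.dist (h.layer_zero_mem j) h2
    (le_average_layer_zero h.nonneg h.dist h2 h.mean_pos h.moment (h.searchLevel_pos j) ?_) hθ
  rw [searchLevel_eq]
  have := h.level_le j hj
  gcongr

/-- Up to round `J` an accepted scale has the right order of magnitude, if the angle estimate was
successful. -/
theorem Setting.level_bounds {j : ℕ} (hj : j ≤ J) {θ : ℝ}
    (hθ : |θ - groverAngle d (fractionAngle (layer (searchLevel Δ H j) 0))| ≤
        1 / (16 * (Δ : ℝ))) (hacc : ¬ θ < 3 / (8 * (Δ : ℝ))) :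
    (Δ : ℝ) ^ 2 * mean d ≤ searchLevel Δ H j ∧
      searchLevel Δ H j ≤ 64 * (Δ : ℝ) ^ 2 * mean d := by
  have h2 : (0 : ℝ) < Δ := by exact_mod_cast h.Δ_pos
  have hb := h.searchLevel_pos j
  constructor
  · have : mean d / 2 ≤ H / 2 ^ j := by
      rcases hj.eq_or_lt with rfl | hj
      · exact h.le_level
      · linarith [h.lt_level j hj, h.mean_pos]
    rw [searchLevel_eq]
    nlinarith [pow_pos h2 2]
  · have h3 := lt_average_of_close_of_le h.dist (h.layer_zero_mem j) h2 hθ (not_lt.1 hacc)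
    have h4 := h3.le.trans (average_layer_zero_le h.dist hb)
    rw [div_le_div_iff₀ (by positivity) hb] at h4
    linarith

/-- The probability of an output in `T` when the search starts with round `j`. -/
noncomputable def roundWeight (g₀ : G) (o₀ : EuclideanSpace ℂ Ω)
    (S : SampleSpace Ω G ≃ₗᵢ[ℂ] SampleSpace Ω G) (Δ : ℕ) (H ε δ : ℝ) (T : Set ℝ) (j : ℕ) :
    ℝ≥0∞ :=
  runWeight g₀ o₀ S (searchRound Δ H ε δ) T (.fresh (searchRound Δ H ε δ j)) (startState g₀ o₀)

theorem Setting.roundWeight_eq (T : Set ℝ) (j : ℕ) :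
    roundWeight g₀ o₀ S Δ H ε δ T j =
      (estimateAngle (fractionAngle (layer (searchLevel Δ H j) 0)) (searchPrecision Δ)
        (repetitions (searchPrecision Δ) (δ / 8 / 2 ^ j))).expect 0 (successProb d) fun θ =>
      if θ < 3 / (8 * (Δ : ℝ)) then roundWeight g₀ o₀ S Δ H ε δ T (j + 1)
      else (estimateLayers (searchLevel Δ H j) (layerPrecision Δ ε)
        (repetitions (layerPrecision Δ ε) (δ / (4 * (lastLayer ε + 1))))
        (lastLayer ε + 1)).expect 0 (successProb d) (T.indicator 1) := by
  rw [roundWeight, runWeight_fresh _ h.norm_g h.norm_o h.dist h.sampler, expect_searchRound]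
  congr 1
  funext θ
  split_ifs
  · rfl
  · congr 1
    funext s
    rw [Memory.ofResult, runWeight_halted, norm_startState h.norm_g h.norm_o]
    simp only [one_pow, ENNReal.ofReal_one]
    rfl

/-- The induction step of `Setting.one_le_roundWeight_add`. -/
theorem Setting.one_le_roundWeight_add_of_next (j : ℕ) (hj : j ≤ J) (hnext : j < J →
    1 ≤ roundWeight g₀ o₀ S Δ H ε δ {m : ℝ | |m - mean d| ≤ ε * mean d} (j + 1) +
    ENNReal.ofReal (δ / 4 + δ / 4 / 2 ^ (j + 1))) :
    1 ≤ roundWeight g₀ o₀ S Δ H ε δ {m : ℝ | |m - mean d| ≤ ε * mean d} j +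
    ENNReal.ofReal (δ / 4 + δ / 4 / 2 ^ j) := by
  have hδ := h.δ_pos
  have herr : ENNReal.ofReal (δ / 4 + δ / 4 / 2 ^ j) =
      ENNReal.ofReal (δ / 4 + δ / 4 / 2 ^ (j + 1)) + 1 * ENNReal.ofReal (δ / 8 / 2 ^ j) := by
    rw [one_mul, ← ENNReal.ofReal_add (by positivity) (by positivity)]
    congr 1
    rw [pow_succ]
    field_simp
    ring
  rw [herr, ← add_assoc, h.roundWeight_eq]
  refine one_le_expect_add (successProb_mem d) _ (fun θ hθ => ?_) (fun θ => le_add_self)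
    (failProb_search_le d h.Δ_pos hδ H j)
  split_ifs with hlt
  · refine hnext (lt_of_not_ge fun hJ => ?_)
    exact h.le_of_close hJ hθ hlt
  · obtain ⟨hb, hb2⟩ := h.level_bounds hj hθ hlt
    have h1 := one_le_expect_add (successProb_mem d) _ (x := 0) (z := 1)
      (F := ({m : ℝ | |m - mean d| ≤ ε * mean d} : Set ℝ).indicator 1)
      (fun s hs => by
        rw [Set.indicator_of_mem (show s ∈ {m : ℝ | |m - mean d| ≤ ε * mean d} from hs)]
        simp) (fun s => le_add_self)
      (failProb_layers_le h.nonneg h.dist h.Δ_pos h.ε_pos h.ε_lt hδ h.mean_pos h.moment hb hb2)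
    refine h1.trans ?_
    rw [add_zero, one_mul]
    gcongr
    have : 0 < δ / 4 / 2 ^ (j + 1) := by positivity
    linarith

/-- The errors of the rounds `j, …, J` sum up to at most `δ / 4 / 2 ^ j`, and the final estimate
contributes `δ / 4`. -/
theorem Setting.one_le_roundWeight_add (k : ℕ) : ∀ j, j + k = J →
    1 ≤ roundWeight g₀ o₀ S Δ H ε δ {m : ℝ | |m - mean d| ≤ ε * mean d} j +
      ENNReal.ofReal (δ / 4 + δ / 4 / 2 ^ j) := by
  induction k with
  | zero =>
    intro j hj
    have hJ : J ≤ j := by omega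
    exact h.one_le_roundWeight_add_of_next j (by omega) fun hlt => absurd hlt (by omega)
  | succ k ih =>
    intro j hj
    exact h.one_le_roundWeight_add_of_next j (by omega) fun _ => ih (j + 1) (by omega)

/-- From round `J` on every round stops with probability at least `1 / 2`. -/
theorem Setting.one_le_roundWeight_univ_add (n : ℕ) : ∀ j, J ≤ j →
    1 ≤ roundWeight g₀ o₀ S Δ H ε δ Set.univ j + (2⁻¹ : ℝ≥0∞) ^ n := by
  induction n with
  | zero => intro j _; simp
  | succ n ih =>
    intro j hj
    have hδ := h.δ_pos
    have hδ1 := h.δ_lt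
    rw [h.roundWeight_eq, pow_succ, ← add_zero (Protocol.expect _ _ _ _)]
    have h2 : ENNReal.ofReal (δ / 8 / 2 ^ j) ≤ 2⁻¹ := by
      have : (2⁻¹ : ℝ≥0∞) = ENNReal.ofReal 2⁻¹ := by
        rw [ENNReal.ofReal_inv_of_pos (by norm_num)]; simp
      rw [this]
      apply ENNReal.ofReal_le_ofReal
      have : δ / 8 / 2 ^ j ≤ δ / 8 := div_le_self (by positivity) (one_le_pow₀ (by norm_num))
      linarith
    have hone : ∀ N b L, (estimateLayers (Ω := Ω) b (layerPrecision Δ ε) N L).expect 0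
        (successProb d) (Set.univ.indicator 1) = 1 := fun N b L => by
      rw [Set.indicator_univ]
      exact expect_const (successProb_mem d) _ 1
    refine one_le_expect_add (successProb_mem d) _ (fun θ hθ => ?_) (fun θ => ?_)
      ((failProb_search_le d h.Δ_pos hδ H j).trans h2)
    · rw [if_neg (h.le_of_close hj hθ), hone, add_zero]
    · split_ifs with hlt
      · rw [add_zero]
        exact ih (j + 1) (by omega)
      · rw [hone, add_assoc]
        exact le_self_add

theorem Setting.one_le_roundWeight_univ (k : ℕ) : ∀ j, J ≤ j + k →
    1 ≤ roundWeight g₀ o₀ S Δ H ε δ Set.univ j := by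
  induction k with
  | zero =>
    intro j hj
    refine ENNReal.le_of_forall_pos_le_add fun η hη _ => ?_
    obtain ⟨n, hn⟩ := ENNReal.exists_inv_two_pow_lt (a := (η : ℝ≥0∞)) (by simpa using hη.ne')
    exact (h.one_le_roundWeight_univ_add n j hj).trans (by gcongr)
  | succ k ih =>
    intro j hj
    rw [h.roundWeight_eq]
    rw [← expect_const (successProb_mem d) (estimateAngle
      (fractionAngle (layer (searchLevel Δ H j) 0)) (searchPrecision Δ)
        (repetitions (searchPrecision Δ) (δ / 8 / 2 ^ j))) 1]
    refine expect_mono _ _ _ fun θ => ?_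
    split_ifs
    · exact ih (j + 1) (by omega)
    · rw [Set.indicator_univ]
      exact (expect_const (successProb_mem d) _ 1).ge

/-- The expected number of samples, if round `j` uses at most `a + A j`. The bound is a
supersolution of the recursion for the expected costs from round `j` on, in which the rounds from
`J` on are followed by another one with probability at most `1 / 2`. -/
theorem Setting.runSamples_le {a A : ℝ} (ha : 0 ≤ a) (hA : 0 ≤ A)
    (hcost : ∀ j, (roundCost Δ ε δ j : ℝ) ≤ a + A * j) (n : ℕ) : ∀ j,
    runSamples g₀ o₀ S (searchRound Δ H ε δ) n (.fresh (searchRound Δ H ε δ j))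
      (startState g₀ o₀) ≤
    ENNReal.ofReal ((J - j : ℕ) * (a + A * J) + 2 * (a + A * max j J + 2 * A)) := by
  induction n with
  | zero => intro j; simp [runSamples, Algorithm.queryWeight]
  | succ n ih =>
    intro j
    have hδ := h.δ_pos
    have hδ1 := h.δ_lt
    refine (runSamples_fresh _ h.norm_g h.norm_o h.dist h.sampler _ n).trans ?_
    refine (expect_le_maxCost_add (successProb_mem d) _ _ _).trans ?_
    have hc : (searchRound (Ω := Ω) Δ H ε δ j).maxCost experimentCost ≤
        ENNReal.ofReal (a + A * j) := by
      refine (maxCost_searchRound_le _ _ _ _ _).trans ?_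
      rw [← ENNReal.ofReal_natCast]
      exact ENNReal.ofReal_le_ofReal (hcost j)
    have hzero : ∀ s : ℝ, runSamples g₀ o₀ S (searchRound Δ H ε δ) n
        (Memory.ofResult (searchRound Δ H ε δ) (.inl s)) (startState g₀ o₀) = 0 := by
      intro s
      cases n <;> rfl
    set B : ℝ := (J - (j + 1) : ℕ) * (a + A * J) + 2 * (a + A * max (j + 1 : ℕ) J + 2 * A) with hB
    have hB0 : 0 ≤ B := by positivity
    have hlayers : ∀ (b : ℝ) (m N L : ℕ), (estimateLayers (Ω := Ω) b m N L).expect 0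
        (successProb d) (fun _ => 0) = 0 := fun b m N L => expect_const (successProb_mem d) _ 0
    have hnext : (searchRound Δ H ε δ j).expect 0 (successProb d) (fun a =>
        runSamples g₀ o₀ S (searchRound Δ H ε δ) n
          (Memory.ofResult (searchRound Δ H ε δ) a) (startState g₀ o₀)) ≤
        ENNReal.ofReal (if J ≤ j then B / 2 else B) := by
      rw [expect_searchRound]
      simp only [hzero, hlayers]
      by_cases hj : J ≤ j
      · rw [if_pos hj]
        refine (expect_le_add_mul_failProb (successProb_mem d) _ (x := 0) (z := ENNReal.ofReal B)
          (S := fun θ => |θ - groverAngle d (fractionAngle (layer (searchLevel Δ H j) 0))| ≤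
            1 / (16 * (Δ : ℝ)))
          (fun θ hθ => by rw [if_neg (h.le_of_close hj hθ)]) (fun θ => ?_)).trans ?_
        · rw [zero_add]
          split_ifs
          · exact ih (j + 1)
          · exact zero_le
        · rw [zero_add]
          refine (mul_le_mul' le_rfl (failProb_search_le d h.Δ_pos hδ H j)).trans ?_
          rw [← ENNReal.ofReal_mul hB0]
          apply ENNReal.ofReal_le_ofReal
          have h1 : δ / 8 / 2 ^ j ≤ δ / 8 :=
            div_le_self (by positivity) (one_le_pow₀ (by norm_num))
          nlinarith
      · rw [if_neg hj, ← expect_const (successProb_mem d) (estimateAngle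
          (fractionAngle (layer (searchLevel Δ H j) 0)) (searchPrecision Δ)
          (repetitions (searchPrecision Δ) (δ / 8 / 2 ^ j))) (ENNReal.ofReal B)]
        refine expect_mono _ _ _ fun θ => ?_
        split_ifs
        · exact ih (j + 1)
        · exact zero_le
    refine (add_le_add hc hnext).trans ?_
    rw [← ENNReal.ofReal_add (by positivity) (by split_ifs <;> positivity)]
    apply ENNReal.ofReal_le_ofReal
    by_cases hj : J ≤ j
    · have hj' : (J : ℝ) ≤ j := by exact_mod_cast hj
      have e1 : J - j = 0 := by omega
      have e2 : J - (j + 1) = 0 := by omega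
      rw [if_pos hj, hB, e1, e2, max_eq_left hj, max_eq_left (by omega)]
      push_cast
      nlinarith
    · have hj' : (j : ℝ) + 1 ≤ J := by exact_mod_cast (not_le.1 hj)
      obtain ⟨k, hk⟩ : ∃ k, J - j = k + 1 := ⟨J - j - 1, by omega⟩
      have e2 : J - (j + 1) = k := by omega
      rw [if_neg hj, hB, hk, e2, max_eq_right (by omega),
        max_eq_right (by omega)]
      push_cast
      nlinarith

end Correctness

/-! ### The number of samples in terms of the parameters -/

theorem natCast_le_of_two_pow_le {n q r : ℕ} {Y : ℝ} (hY : 1 ≤ Y)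
    (h : (2 : ℝ) ^ n ≤ 2 ^ q * Y ^ r) : (n : ℝ) ≤ q + 2 * r * Real.log Y := by
  have hl := Real.log_two_gt_d9
  have hY0 := Real.log_nonneg hY
  have h1 := Real.log_le_log (by positivity) h
  rw [Real.log_mul (by positivity) (by positivity), Real.log_pow, Real.log_pow, Real.log_pow] at h1
  by_contra! hc
  have h2 : 0 ≤ (r : ℝ) * Real.log Y := by positivity
  nlinarith [mul_lt_mul_of_pos_right hc (show 0 < Real.log 2 by linarith)]

theorem repetitions_le (n : ℕ) {η : ℝ} (hη : 0 < η) (hη1 : η ≤ 1) :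
    (repetitions n η : ℝ) ≤ 65536 * (2 + 2 * ((n : ℝ) + 2) + Real.log (1 / η)) := by
  have hn : (0 : ℝ) ≤ n := Nat.cast_nonneg n
  have h1 : Real.log (2 * (n + 2) ^ 2 / η) =
      Real.log 2 + 2 * Real.log ((n : ℝ) + 2) + Real.log (1 / η) := by
    rw [div_eq_mul_one_div, Real.log_mul (by positivity) (by positivity),
      Real.log_mul (by positivity) (by positivity), Real.log_pow]
    push_cast; ring
  have h2 : 0 ≤ Real.log (1 / η) := Real.log_nonneg (by rw [le_div_iff₀ hη]; linarith)
  have h3 : 0 ≤ Real.log ((n : ℝ) + 2) := Real.log_nonneg (by linarith)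
  have h4 : Real.log ((n : ℝ) + 2) ≤ n + 2 := Real.log_le_self (by positivity)
  have h5 := Real.log_two_lt_d9
  have h6 := Real.log_two_gt_d9
  have h7 := (Nat.ceil_lt_add_one (a := 65536 * Real.log (2 * (n + 2) ^ 2 / η))
    (by rw [h1]; positivity)).le
  rw [repetitions]
  push_cast
  rw [h1] at h7 ⊢
  linarith

theorem log_one_div_div {δ c : ℝ} (hδ : 0 < δ) (hc : 0 < c) :
    Real.log (1 / (δ / c)) = Real.log (1 / δ) + Real.log c := by
  rw [one_div_div, div_eq_mul_one_div, Real.log_mul hc.ne' (by positivity), add_comm]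

/-- The numbers of layers and the precisions are `O(log Y)`, and the numbers of repetitions are
`O((1 + log (1 / δ)) log Y + j)`. This gives `O(Δ)` and `O(Δ / ε)` samples for the test and for the
final estimate, up to the logarithmic factors. -/
theorem roundCost_le {Δ : ℕ} (hΔ : 1 ≤ Δ) {ε δ Y : ℝ} (hε : 0 < ε) (hε1 : ε < 1) (hδ : 0 < δ)
    (hδ1 : δ < 1) (hY : 3 ≤ Y) (hRY : (Δ : ℝ) / ε ≤ Y) (j : ℕ) :
    (roundCost Δ ε δ j : ℝ) ≤
      (12960 * 65536 * 24 + 7 * 256 * 65536 * 46 * 5 * 130 * 7) *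
        ((Δ : ℝ) / ε * (1 + Real.log (1 / δ)) * Real.log Y ^ 5) +
      12960 * 65536 * ((Δ : ℝ) / ε * (1 + Real.log (1 / δ)) * Real.log Y ^ 5) * j := by
  set D : ℝ := (Δ : ℝ) with hD
  set R : ℝ := D / ε with hR
  set ℓ : ℝ := Real.log Y with hℓ
  set lam : ℝ := 1 + Real.log (1 / δ) with hlam
  have hD1 : 1 ≤ D := by rw [hD]; exact_mod_cast hΔ
  have hDR : D ≤ R := by rw [hR, le_div_iff₀ hε]; nlinarith
  have hεR : 1 / ε ≤ R := by rw [hR]; gcongr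
  have hR1 : 1 ≤ R := hD1.trans hDR
  have hℓ1 : 1 ≤ ℓ := by
    rw [hℓ, Real.le_log_iff_exp_le (by linarith)]
    linarith [Real.exp_one_lt_d9]
  have hlam1 : 1 ≤ lam := by
    have := Real.log_nonneg (show 1 ≤ 1 / δ by rw [le_div_iff₀ hδ]; linarith)
    linarith
  have hℓY : ℓ ≤ Y := Real.log_le_self (by linarith)
  -- the precision of the search
  set n₁ := searchPrecision Δ with hn₁
  have hp₁ : (2 : ℝ) ^ n₁ ≤ 32 * D := by
    have : ((2 ^ n₁ : ℕ) : ℝ) ≤ ((2 * (16 * Δ) : ℕ) : ℝ) :=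
      Nat.cast_le.2 (two_pow_clog_le (by omega))
    push_cast at this
    linarith
  have hb₁ : (n₁ : ℝ) + 2 ≤ 9 * ℓ := by
    have := natCast_le_of_two_pow_le (n := n₁) (q := 5) (r := 1) (Y := Y) (by linarith)
      (by norm_num; linarith)
    push_cast at this
    linarith
  -- the number of layers
  set L := lastLayer ε with hL
  have hpL : (2 : ℝ) ^ L ≤ 10 * (1 / ε) := by
    refine (two_pow_clog_ceil_le (by positivity)).trans ?_
    have : 1 ≤ 1 / ε := by rw [le_div_iff₀ hε]; linarith
    rw [div_eq_mul_one_div 4 ε]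
    linarith
  have hbL : (L : ℝ) + 1 ≤ 7 * ℓ := by
    have := natCast_le_of_two_pow_le (n := L) (q := 4) (r := 1) (Y := Y) (by linarith)
      (by norm_num; norm_num at hpL hεR; linarith)
    push_cast at this
    linarith
  have hL0 : (0 : ℝ) ≤ L := Nat.cast_nonneg L
  -- the precision of the layers
  set n₂ := layerPrecision Δ ε with hn₂
  have hp₂ : (2 : ℝ) ^ n₂ ≤ 130 * R * (7 * ℓ) := by
    refine (two_pow_clog_ceil_le (by positivity)).trans ?_
    have e1 : 64 * (Δ : ℝ) * ((lastLayer ε : ℕ) + 1) / ε = 64 * (R * (L + 1)) := by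
      rw [hR, hD, hL]; ring
    have e2 : R * (L + 1) ≤ R * (7 * ℓ) := by gcongr
    have e3 : 1 ≤ R * (7 * ℓ) := by nlinarith
    rw [e1]
    linarith
  have hb₂ : (n₂ : ℝ) + 2 ≤ 16 * ℓ := by
    have h1 : R * ℓ ≤ Y * Y := by gcongr
    have := natCast_le_of_two_pow_le (n := n₂) (q := 10) (r := 2) (Y := Y) (by linarith)
      (by nlinarith)
    push_cast at this
    linarith
  have hlℓ : lam ≤ lam * ℓ := by nlinarith
  have hℓl : ℓ ≤ lam * ℓ := by nlinarith
  have h1l : 1 ≤ lam * ℓ := by nlinarith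
  have hlog2 := Real.log_two_lt_d9
  have hN₁ : (repetitions n₁ (δ / 8 / 2 ^ j) : ℝ) ≤ 65536 * (24 * (lam * ℓ) + j) := by
    have h1 : δ / 8 / 2 ^ j ≤ 1 := by
      have : δ / 8 / 2 ^ j ≤ δ / 8 := div_le_self (by positivity) (one_le_pow₀ (by norm_num))
      linarith
    refine (repetitions_le n₁ (by positivity) h1).trans ?_
    rw [log_one_div_div (by positivity) (by positivity), log_one_div_div hδ (by norm_num),
      Real.log_pow]
    have h8 : Real.log 8 ≤ 3 := by
      rw [show (8 : ℝ) = 2 ^ 3 by norm_num, Real.log_pow]; push_cast; linarith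
    have hj : (j : ℝ) * Real.log 2 ≤ j := by
      have : (0 : ℝ) ≤ j := Nat.cast_nonneg j
      nlinarith
    linarith
  have hN₂ : (repetitions n₂ (δ / (4 * (L + 1))) : ℝ) ≤ 65536 * (46 * (lam * ℓ)) := by
    have h1 : δ / (4 * ((L : ℝ) + 1)) ≤ 1 := by
      rw [div_le_one (by positivity)]; linarith
    refine (repetitions_le n₂ (by positivity) h1).trans ?_
    rw [log_one_div_div hδ (by positivity), Real.log_mul (by norm_num) (by positivity)]
    have h4 : Real.log 4 ≤ 2 := by
      rw [show (4 : ℝ) = 2 ^ 2 by norm_num, Real.log_pow]; push_cast; linarith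
    have h5 : Real.log ((L : ℝ) + 1) ≤ L + 1 := Real.log_le_self (by positivity)
    linarith
  have hj0 : (0 : ℝ) ≤ j := Nat.cast_nonneg j
  have hc₁ : (angleCost n₁ (repetitions n₁ (δ / 8 / 2 ^ j)) : ℝ) ≤
      12960 * 65536 * (D * ℓ ^ 2 * (24 * (lam * ℓ) + j)) := by
    rw [angleCost]
    push_cast
    calc _ ≤ (9 * ℓ) ^ 2 * (65536 * (24 * (lam * ℓ) + j)) * (5 * (32 * D)) := by gcongr
      _ = _ := by ring
  have hc₂ : ((L : ℝ) + 1) * (angleCost n₂ (repetitions n₂ (δ / (4 * (L + 1)))) : ℝ) ≤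
      7 * 256 * 65536 * 46 * 5 * 130 * 7 * (R * lam * ℓ ^ 5) := by
    rw [angleCost]
    push_cast
    calc _ ≤ (7 * ℓ) * ((16 * ℓ) ^ 2 * (65536 * (46 * (lam * ℓ))) *
          (5 * (130 * R * (7 * ℓ)))) := by gcongr
      _ = _ := by ring
  have hpow2 : ℓ ^ 2 ≤ ℓ ^ 5 := pow_le_pow_right₀ hℓ1 (by norm_num)
  have hpow3 : ℓ ^ 3 ≤ ℓ ^ 5 := pow_le_pow_right₀ hℓ1 (by norm_num)
  have hm1 : D * ℓ ^ 2 ≤ R * lam * ℓ ^ 5 := by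
    have : R * 1 ≤ R * lam := by gcongr
    gcongr
    linarith
  have hm2 : D * ℓ ^ 2 * (lam * ℓ) ≤ R * lam * ℓ ^ 5 := by
    calc D * ℓ ^ 2 * (lam * ℓ) = D * lam * ℓ ^ 3 := by ring
      _ ≤ _ := by gcongr
  have hm1j := mul_le_mul_of_nonneg_right hm1 hj0
  rw [roundCost]
  push_cast
  linarith

/-- The number of rounds until the test has to accept. -/
theorem exists_last_level {H μ : ℝ} (hH : 0 < H) (hμ : 0 < μ) (hμH : μ < H) :
    ∃ J : ℕ, (∀ j, J ≤ j → H / 2 ^ j ≤ μ) ∧ (∀ j, j < J → μ < H / 2 ^ j) ∧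
      μ / 2 ≤ H / 2 ^ J ∧ (J : ℝ) ≤ 1 + 2 * Real.log (H / μ) := by
  classical
  have hex : ∃ j : ℕ, H / 2 ^ j ≤ μ := by
    obtain ⟨j, hj⟩ := pow_unbounded_of_one_lt (H / μ) (one_lt_two (α := ℝ))
    refine ⟨j, ?_⟩
    rw [div_lt_iff₀ hμ] at hj
    rw [div_le_iff₀ (by positivity)]
    linarith
  have hbefore : ∀ j, j < Nat.find hex → μ < H / 2 ^ j := fun j hj => not_le.1 (Nat.find_min hex hj)
  have hlog : 0 ≤ Real.log (H / μ) := Real.log_nonneg (by rw [le_div_iff₀ hμ]; linarith)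
  refine ⟨Nat.find hex, fun j hj => ?_, hbefore, ?_, ?_⟩
  · refine le_trans ?_ (Nat.find_spec hex)
    gcongr
    norm_num
  · rcases hJ : Nat.find hex with _ | k
    · rw [pow_zero]; linarith
    · have := hbefore k (by omega)
      rw [pow_succ, ← div_div]
      linarith
  · rcases hJ : Nat.find hex with _ | k
    · push_cast; linarith
    · have h1 := hbefore k (by omega)
      have h2 := natCast_le_of_two_pow_le (n := k) (q := 0) (r := 1) (Y := H / μ)
        (by rw [le_div_iff₀ hμ]; linarith) (by
          rw [lt_div_iff₀ (by positivity)] at h1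
          rw [pow_zero, one_mul, pow_one, le_div_iff₀ hμ]
          linarith)
      push_cast at h2 ⊢
      linarith


end QuantumSampling

open QuantumSampling in
theorem mainTheorem2 :
    ∃ (C : ℝ) (k : ℕ), 0 < C ∧
      ∀ (Ω : Finset ℝ), (∀ x ∈ Ω, 0 ≤ x) →
      ∀ (G : Type u) [NormedAddCommGroup G] [InnerProductSpace ℂ G] [CompleteSpace G]
        (g₀ : G) (o₀ : EuclideanSpace ℂ Ω), ‖g₀‖ = 1 → ‖o₀‖ = 1 →
      ∀ (Δ : ℕ) (H ε δ : ℝ), 0 < H → 0 < ε → ε < 1 → 0 < δ → δ < 1 →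
      ∃ A : QuantumSampling.Algorithm Ω G,
        ∀ (d : Ω → ℝ), d ∈ stdSimplex ℝ Ω →
        ∀ S : QuantumSampling.SampleSpace Ω G ≃ₗᵢ[ℂ] QuantumSampling.SampleSpace Ω G,
          QuantumSampling.IsSampler g₀ o₀ d S →
          0 < QuantumSampling.mean d →
          QuantumSampling.rootSecondMoment d / QuantumSampling.mean d ≤ (Δ : ℝ) →
          QuantumSampling.mean d < H →
          A.outputProb g₀ o₀ S Set.univ = 1 ∧
          ENNReal.ofReal (1 - δ) ≤
            A.outputProb g₀ o₀ S
              {m : ℝ | |m - QuantumSampling.mean d| ≤ ε * QuantumSampling.mean d} ∧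
          ∀ X : ℝ,
            X = (Δ : ℝ) * ε⁻¹ * (1 + Real.log (H / QuantumSampling.mean d)) ^ 3 *
              (1 + Real.log (1 / δ)) →
            A.expectedSamples g₀ o₀ S ≤ ENNReal.ofReal (C * X * Real.log (2 + X) ^ k) := by
  refine ⟨25 * (12960 * 65536 * 24 + 7 * 256 * 65536 * 46 * 5 * 130 * 7 + 12960 * 65536), 5,
    by norm_num, ?_⟩
  intro Ω hΩ G _ _ _ g₀ o₀ hg ho Δ H ε δ hH hε hε1 hδ hδ1
  refine ⟨compile g₀ o₀ (searchRound Δ H ε δ), ?_⟩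
  intro d hd S hS hμ hΔ hμH
  have hmoment : average d (fun x => x ^ 2) ≤ (Δ : ℝ) ^ 2 * mean d ^ 2 := by
    rw [div_le_iff₀ hμ, rootSecondMoment, Real.sqrt_le_iff, mul_pow] at hΔ
    exact hΔ.2
  have hΔ1 : 1 ≤ Δ := by
    by_contra! hc
    have h0 : Δ = 0 := by omega
    have h1 := mean_sub_average_min_le hd (half_pos hμ)
    have h2 : average d (fun x => min x (mean d / 2)) ≤ mean d / 2 := by
      refine (average_mono hd fun x _ => min_le_right _ _).trans (le_of_eq ?_)
      rw [average, ← Finset.sum_mul, hd.2, one_mul]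
    have h3 : average d (fun x => x ^ 2) / (mean d / 2) ≤ 0 := by
      refine div_nonpos_of_nonpos_of_nonneg ?_ (half_pos hμ).le
      simpa [h0] using hmoment
    linarith
  obtain ⟨J, hlast, hbefore, hhalf, hJ⟩ := exists_last_level hH hμ hμH
  have h : Setting g₀ o₀ S d Δ H ε δ J := ⟨hΩ, hg, ho, hd, hS, hΔ1, hH, hε, hε1, hδ, hδ1, hμ,
    hmoment, hlast, hbefore, hhalf⟩
  refine ⟨le_antisymm (outputProb_compile_le_one _ hg ho _)
    (h.one_le_roundWeight_univ J 0 (by omega)), ?_, ?_⟩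
  · have h1 := h.one_le_roundWeight_add J 0 (by omega)
    rw [ENNReal.ofReal_sub _ hδ.le, ENNReal.ofReal_one, tsub_le_iff_right]
    refine h1.trans (add_le_add le_rfl (ENNReal.ofReal_le_ofReal ?_))
    rw [pow_zero]
    linarith
  · intro X hX
    set Λ : ℝ := 1 + Real.log (H / mean d) with hΛ
    set lam : ℝ := 1 + Real.log (1 / δ) with hlam
    have hΛ1 : 1 ≤ Λ := by
      have := Real.log_nonneg (show 1 ≤ H / mean d by rw [le_div_iff₀ hμ]; linarith)
      linarith
    have hlam1 : 1 ≤ lam := by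
      have := Real.log_nonneg (show 1 ≤ 1 / δ by rw [le_div_iff₀ hδ]; linarith)
      linarith
    have hD1 : (1 : ℝ) ≤ Δ := by exact_mod_cast hΔ1
    have hR1 : 1 ≤ (Δ : ℝ) / ε := by rw [le_div_iff₀ hε]; linarith
    have hX' : X = (Δ : ℝ) / ε * (Λ ^ 3 * lam) := by rw [hX]; ring
    have hRX : (Δ : ℝ) / ε ≤ X := by
      rw [hX']
      exact le_mul_of_one_le_right (by positivity)
        (one_le_mul_of_one_le_of_one_le (one_le_pow₀ hΛ1) hlam1)
    have hcost := roundCost_le (Y := 2 + X) hΔ1 hε hε1 hδ hδ1 (by linarith) (by linarith)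
    have hℓ : 0 ≤ Real.log (2 + X) := Real.log_nonneg (by linarith)
    rw [expectedSamples_compile]
    refine iSup_le fun n => (h.runSamples_le (by positivity) (by positivity) hcost n 0).trans ?_
    apply ENNReal.ofReal_le_ofReal
    set q : ℝ := (Δ : ℝ) / ε * lam * Real.log (2 + X) ^ 5 with hq
    have hq0 : 0 ≤ q := by positivity
    have hJ0 : (0 : ℝ) ≤ J := Nat.cast_nonneg J
    have hJΛ : ((J : ℝ) + 4) ^ 2 ≤ 25 * Λ ^ 3 := by
      have h1 : ((J : ℝ) + 4) ≤ 5 * Λ := by linarith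
      calc ((J : ℝ) + 4) ^ 2 ≤ (5 * Λ) ^ 2 := by gcongr
        _ = 25 * Λ ^ 2 := by ring
        _ ≤ 25 * Λ ^ 3 := by gcongr; norm_num
    have hbound : ∀ a A : ℝ, 0 ≤ a → 0 ≤ A →
        ((J - 0 : ℕ) : ℝ) * (a + A * J) + 2 * (a + A * (max 0 J : ℕ) + 2 * A) ≤
          ((J : ℝ) + 4) ^ 2 * (a + A) := by
      intro a A ha hA
      rw [Nat.sub_zero, max_eq_right (Nat.zero_le J)]
      nlinarith [mul_nonneg hJ0 ha, mul_nonneg hJ0 hA, mul_nonneg (mul_nonneg hJ0 hJ0) ha]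
    refine (hbound _ _ (by positivity) (by positivity)).trans ?_
    rw [← add_mul]
    refine (mul_le_mul_of_nonneg_right hJΛ (by positivity)).trans (le_of_eq ?_)
    rw [hq]
    generalize Real.log (2 + X) = ℓ
    rw [hX']
    ring
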